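/- **Strong completeness of $\mathsf{QBK}$.** Let $\sigma$ be an arbitrary signature consisting of predicate symbols with arities and constant symbols (no function symbols, no equality). Formulas are built from atomic formulas $P(t_1,\dots,t_n)$ (each term $t_i$ is a constant or one of countably infinitely many variables) and $\bot$ by $\to,\wedge,\vee$, strong negation $\sim$, $\Box,\Diamond,\forall x,\exists x$; sentences are formulas without free variables. Write $\neg\Phi:=\Phi\to\bot$, $\Phi\leftrightarrow\Psi:=(\Phi\to\Psi)\wedge(\Psi\to\Phi)$, $\Phi\Leftrightarrow\Psi:=(\Phi\leftrightarrow\Psi)\wedge(\sim\Phi\leftrightarrow\sim\Psi)$. *Calculus.* $\mathsf{QBK}_\sigma$ is the least set of formulas containing all instances of the schemes - $\Phi\to(\Psi\to\Phi)$; $(\Phi\to(\Psi\to\Theta))\to((\Phi\to\Psi)\to(\Phi\to\Theta))$; $\Phi\wedge\Psi\to\Phi$; $\Phi\wedge\Psi\to\Psi$; $\Phi\to(\Psi\to\Phi\wedge\Psi)$; $\Phi\to\Phi\vee\Psi$; $\Psi\to\Phi\vee\Psi$; $(\Phi\to\Theta)\to((\Psi\to\Theta)\to(\Phi\vee\Psi\to\Theta))$;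 $\Phi\vee\neg\Phi$; $\bot\to\Phi$; - $\sim\sim\Phi\leftrightarrow\Phi$; $\sim(\Phi\to\Psi)\leftrightarrow(\Phi\wedge\sim\Psi)$; $\sim(\Phi\vee\Psi)\leftrightarrow(\sim\Phi\wedge\sim\Psi)$; $\sim(\Phi\wedge\Psi)\leftrightarrow(\sim\Phi\vee\sim\Psi)$; $\sim\bot$; - $(\Box\Phi\wedge\Box\Psi)\to\Box(\Phi\wedge\Psi)$; $\Box(\Phi\to\Phi)$; $\neg\Box\Phi\leftrightarrow\Diamond\neg\Phi$; $\neg\Diamond\Phi\leftrightarrow\Box\neg\Phi$; $\Box\Phi\Leftrightarrow\sim\Diamond\sim\Phi$; $\Diamond\Phi\Leftrightarrow\sim\Box\sim\Phi$; - $\forall x\,\Phi\to\Phi(x/t)$ and $\Phi(x/t)\to\exists x\,\Phi$ for $t$ free for $x$ in $\Phi$; $\sim\forall x\,\Phi\leftrightarrow\exists x\sim\Phi$; $\sim\exists x\,\Phi\leftrightarrow\forall x\sim\Phi$; and closed under (MP) from $\Phi$ and $\Phi\to\Psi$ infer $\Psi$; (MB), (MD) from $\Phi\to\Psi$ infer $\Box\Phi\to\Box\Psi$,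 respectively $\Diamond\Phi\to\Diamond\Psi$; (BR1) from $\Phi\to\Psi$ infer $\Phi\to\forall x\,\Psi$ if $x$ is not free in $\Phi$; (BR2) from $\Phi\to\Psi$ infer $\exists x\,\Phi\to\Psi$ if $x$ is not free in $\Psi$. For a set $\Gamma$ of sentences and a set $\Delta$ of formulas, $\Gamma\vdash\Delta$ means that some disjunction $\Phi_1\vee\dots\vee\Phi_n$ ($n\ge 0$, all $\Phi_i\in\Delta$; for $n=0$ it is $\bot$) can be obtained from elements of $\Gamma\cup\mathsf{QBK}_\sigma$ by the rules MP, BR1, BR2. *Semantics.* A $\mathsf{QBK}_\sigma$-model consists of a non-empty set $W$ of worlds, a relation $R\subseteq W\times W$, and, for each $w\in W$, two $\sigma$-structures $\mathfrak A_w^+,\mathfrak A_w^-$ with the same non-empty domain $A_w$ and the same interpretation of every constant, such that $uRv$ implies $A_u\subseteq A_v$ and $c^{\mathfrak A_u^+}=c^{\mathfrak A_v^+}$ for every constant $c$ of $\sigma$. An $A_w$-sentence is a sentence of $\sigma$ enlarged by a new constant $\underline a$, denoting $a$, for each $a\in A_w$. Verification $w\Vdash^+$ and falsification $w\Vdash^-$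 of $A_w$-sentences are defined by recursion: - for atomic $\Theta$: $w\Vdash^{\pm}\Theta$ iff $\Theta$ is true in $\mathfrak A^{\pm}_w$; $w\nVdash^+\bot$ and $w\Vdash^-\bot$; - $w\Vdash^+\Phi\wedge\Psi$ iff $w\Vdash^+\Phi$ and $w\Vdash^+\Psi$; $w\Vdash^-\Phi\wedge\Psi$ iff $w\Vdash^-\Phi$ or $w\Vdash^-\Psi$; - $w\Vdash^+\Phi\vee\Psi$ iff $w\Vdash^+\Phi$ or $w\Vdash^+\Psi$; $w\Vdash^-\Phi\vee\Psi$ iff $w\Vdash^-\Phi$ and $w\Vdash^-\Psi$; - $w\Vdash^+\Phi\to\Psi$ iff $w\nVdash^+\Phi$ or $w\Vdash^+\Psi$; $w\Vdash^-\Phi\to\Psi$ iff $w\Vdash^+\Phi$ and $w\Vdash^-\Psi$; - $w\Vdash^+\sim\Phi$ iff $w\Vdash^-\Phi$; $w\Vdash^-\sim\Phi$ iff $w\Vdash^+\Phi$; - $w\Vdash^+\Box\Phi$ iff $u\Vdash^+\Phi$ for all $u$ with $wRu$; $w\Vdash^-\Box\Phi$ iff $u\Vdash^-\Phi$ for some $u$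 with $wRu$; - $w\Vdash^+\Diamond\Phi$ iff $u\Vdash^+\Phi$ for some $u$ with $wRu$; $w\Vdash^-\Diamond\Phi$ iff $u\Vdash^-\Phi$ for all $u$ with $wRu$; - $w\Vdash^+\forall x\,\Phi$ iff $w\Vdash^+\Phi(x/\underline a)$ for all $a\in A_w$; $w\Vdash^-\forall x\,\Phi$ iff $w\Vdash^-\Phi(x/\underline a)$ for some $a\in A_w$; - $w\Vdash^+\exists x\,\Phi$ iff $w\Vdash^+\Phi(x/\underline a)$ for some $a\in A_w$; $w\Vdash^-\exists x\,\Phi$ iff $w\Vdash^-\Phi(x/\underline a)$ for all $a\in A_w$. $\Gamma\vDash\Delta$ means: for every $\mathsf{QBK}_\sigma$-model, every world $w$ and every map $\lambda$ from the variables to the constants of $\sigma$ enlarged by the $\underline a$, $a\in A_w$, if $w\Vdash^+\Phi$ for all $\Phi\in\Gamma$, then $w\Vdash^+\lambda\Psi$ for some $\Psi\in\Delta$, where $\lambda\Psi$ is the result of simultaneously replacing the free variables of $\Psi$ according to $\lambda$. **Theorem.** For every set $\Gamma$ of $\sigma$-sentences and every set $\Delta$ of $\sigma$-formulas, $$\Gamma\vdash\Delta\iff\Gamma\vDash\Delta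 .$$ -/

import Mathlib

universe u v w

namespace QBK

/-- A signature without function symbols: predicate symbols with arities, and constant symbols. -/
structure Signature where
  /-- predicate symbols -/
  Pred : Type u
  /-- the arity of a predicate symbol -/
  arity : Pred → ℕ
  /-- constant symbols -/
  Const : Type v

/-- The signature `σ` enlarged by a new constant for every element of `A`. -/
@[reducible] def Signature.adjoin (σ : Signature.{u, v}) (A : Type w) :
    Signature.{u, max v w} where
  Pred := σ.Pred
  arity := σ.arity
  Const := σ.Const ⊕ A

/-- Individual variables, a fixed countably infinite set. -/
abbrev Var : Type := ℕ

/-- A term is a variable or a constant symbol. -/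
inductive Term (σ : Signature.{u, v}) : Type v
  | var (x : Var) : Term σ
  | const (c : σ.Const) : Term σ

/-- The modal first-order formulas; `neg` is the strong negation `∼`. -/
inductive Formula (σ : Signature.{u, v}) : Type (max u v)
  | atom (P : σ.Pred) (ts : Fin (σ.arity P) → Term σ) : Formula σ
  | bot : Formula σ
  | imp (Φ Ψ : Formula σ) : Formula σ
  | and (Φ Ψ : Formula σ) : Formula σ
  | or (Φ Ψ : Formula σ) : Formula σ
  | neg (Φ : Formula σ) : Formula σ
  | box (Φ : Formula σ) : Formula σ
  | dia (Φ : Formula σ) : Formula σ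
  | all (x : Var) (Φ : Formula σ) : Formula σ
  | ex (x : Var) (Φ : Formula σ) : Formula σ

/-- The action of a substitution on terms. -/
def Term.subst {σ : Signature.{u, v}} (s : Var → Term σ) : Term σ → Term σ
  | .var x => s x
  | .const c => .const c

/-- A term of `σ`, read as a term of the enlarged signature. -/
def Term.lift {σ : Signature.{u, v}} (A : Type w) : Term σ → Term (σ.adjoin A)
  | .var x => .var x
  | .const c => .const (Sum.inl c)

namespace Formula

variable {σ : Signature.{u, v}}

/-- The classical negation `Φ → ⊥`. -/
def cneg (Φ : Formula σ) : Formula σ := imp Φ bot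

/-- The equivalence `Φ ↔ Ψ`. -/
def iff (Φ Ψ : Formula σ) : Formula σ := and (imp Φ Ψ) (imp Ψ Φ)

/-- The strong equivalence `Φ ⇔ Ψ`. -/
def siff (Φ Ψ : Formula σ) : Formula σ := and (iff Φ Ψ) (iff (neg Φ) (neg Ψ))

/-- `x` has a free occurrence in the formula. -/
def IsFree (x : Var) : Formula σ → Prop
  | atom _ ts => ∃ i, ts i = .var x
  | bot => False
  | imp Φ Ψ => IsFree x Φ ∨ IsFree x Ψ
  | and Φ Ψ => IsFree x Φ ∨ IsFree x Ψ
  | or Φ Ψ => IsFree x Φ ∨ IsFree x Ψ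
  | neg Φ => IsFree x Φ
  | box Φ => IsFree x Φ
  | dia Φ => IsFree x Φ
  | all y Φ => x ≠ y ∧ IsFree x Φ
  | ex y Φ => x ≠ y ∧ IsFree x Φ

/-- A sentence is a formula without free variables. -/
def IsSentence (Φ : Formula σ) : Prop := ∀ x, ¬ IsFree x Φ

/-- Simultaneous replacement of the free occurrences of every variable `x` by the term `s x`
(bound variables are not renamed). -/
def subst : (Var → Term σ) → Formula σ → Formula σ
  | s, atom P ts => atom P (fun i => (ts i).subst s)
  | _, bot => bot
  | s, imp Φ Ψ => imp (subst s Φ) (subst s Ψ)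
  | s, and Φ Ψ => and (subst s Φ) (subst s Ψ)
  | s, or Φ Ψ => or (subst s Φ) (subst s Ψ)
  | s, neg Φ => neg (subst s Φ)
  | s, box Φ => box (subst s Φ)
  | s, dia Φ => dia (subst s Φ)
  | s, all x Φ => all x (subst (Function.update s x (.var x)) Φ)
  | s, ex x Φ => ex x (subst (Function.update s x (.var x)) Φ)

/-- `Φ(x/t)`. -/
def subst1 (Φ : Formula σ) (x : Var) (t : Term σ) : Formula σ :=
  Φ.subst (Function.update Term.var x t)

/-- `t` is free for `x` in the formula: no free occurrence of `x` lies in the scope of a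
quantifier that binds the variable `t`. -/
def FreeFor (t : Term σ) (x : Var) : Formula σ → Prop
  | atom _ _ => True
  | bot => True
  | imp Φ Ψ => FreeFor t x Φ ∧ FreeFor t x Ψ
  | and Φ Ψ => FreeFor t x Φ ∧ FreeFor t x Ψ
  | or Φ Ψ => FreeFor t x Φ ∧ FreeFor t x Ψ
  | neg Φ => FreeFor t x Φ
  | box Φ => FreeFor t x Φ
  | dia Φ => FreeFor t x Φ
  | all y Φ => IsFree x (all y Φ) → t ≠ .var y ∧ FreeFor t x Φ
  | ex y Φ => IsFree x (ex y Φ) → t ≠ .var y ∧ FreeFor t x Φ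

/-- A formula of `σ`, read as a formula of the enlarged signature. -/
def lift (A : Type w) : Formula σ → Formula (σ.adjoin A)
  | atom P ts => atom (σ := σ.adjoin A) P (fun i => (ts i).lift A)
  | bot => bot
  | imp Φ Ψ => imp (lift A Φ) (lift A Ψ)
  | and Φ Ψ => and (lift A Φ) (lift A Ψ)
  | or Φ Ψ => or (lift A Φ) (lift A Ψ)
  | neg Φ => neg (lift A Φ)
  | box Φ => box (lift A Φ)
  | dia Φ => dia (lift A Φ)
  | all x Φ => all x (lift A Φ)
  | ex x Φ => ex x (lift A Φ)

/-- The disjunction of a finite list of formulas; the empty disjunction is `⊥`. -/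
def disj : List (Formula σ) → Formula σ
  | [] => bot
  | [Φ] => Φ
  | Φ :: Ψ :: l => or Φ (disj (Ψ :: l))

/-- The number of logical symbols of a formula. -/
def complexity : Formula σ → ℕ
  | atom _ _ => 0
  | bot => 0
  | imp Φ Ψ => complexity Φ + complexity Ψ + 1
  | and Φ Ψ => complexity Φ + complexity Ψ + 1
  | or Φ Ψ => complexity Φ + complexity Ψ + 1
  | neg Φ => complexity Φ + 1
  | box Φ => complexity Φ + 1
  | dia Φ => complexity Φ + 1
  | all _ Φ => complexity Φ + 1
  | ex _ Φ => complexity Φ + 1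

theorem complexity_subst (s : Var → Term σ) (Φ : Formula σ) :
    (Φ.subst s).complexity = Φ.complexity := by
  induction Φ generalizing s <;> simp_all [subst, complexity]

theorem complexity_subst1 (Φ : Formula σ) (x : Var) (t : Term σ) :
    (Φ.subst1 x t).complexity = Φ.complexity :=
  complexity_subst _ _

end Formula

open Formula in
/-- The axioms of the Hilbert calculus. -/
inductive AxiomScheme {σ : Signature.{u, v}} : Formula σ → Prop
  -- classical propositional logic
  | i1 (Φ Ψ) : AxiomScheme (imp Φ (imp Ψ Φ))
  | i2 (Φ Ψ Θ) : AxiomScheme (imp (imp Φ (imp Ψ Θ)) (imp (imp Φ Ψ) (imp Φ Θ)))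
  | c1 (Φ Ψ) : AxiomScheme (imp (and Φ Ψ) Φ)
  | c2 (Φ Ψ) : AxiomScheme (imp (and Φ Ψ) Ψ)
  | c3 (Φ Ψ) : AxiomScheme (imp Φ (imp Ψ (and Φ Ψ)))
  | d1 (Φ Ψ) : AxiomScheme (imp Φ (or Φ Ψ))
  | d2 (Φ Ψ) : AxiomScheme (imp Ψ (or Φ Ψ))
  | d3 (Φ Ψ Θ) : AxiomScheme (imp (imp Φ Θ) (imp (imp Ψ Θ) (imp (or Φ Ψ) Θ)))
  | n1 (Φ) : AxiomScheme (or Φ (imp Φ bot))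
  | n2 (Φ) : AxiomScheme (imp bot Φ)
  -- strong negation
  | sn1 (Φ) : AxiomScheme (iff (neg (neg Φ)) Φ)
  | sn2 (Φ Ψ) : AxiomScheme (iff (neg (imp Φ Ψ)) (and Φ (neg Ψ)))
  | sn3 (Φ Ψ) : AxiomScheme (iff (neg (or Φ Ψ)) (and (neg Φ) (neg Ψ)))
  | sn4 (Φ Ψ) : AxiomScheme (iff (neg (and Φ Ψ)) (or (neg Φ) (neg Ψ)))
  | sn5 : AxiomScheme (neg bot)
  -- minimal normal modal logic
  | k1 (Φ Ψ) : AxiomScheme (imp (and (box Φ) (box Ψ)) (box (and Φ Ψ)))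
  | k2 (Φ) : AxiomScheme (box (imp Φ Φ))
  -- interaction of the modalities
  | m1 (Φ) : AxiomScheme (iff (cneg (box Φ)) (dia (cneg Φ)))
  | m2 (Φ) : AxiomScheme (iff (cneg (dia Φ)) (box (cneg Φ)))
  | m3 (Φ) : AxiomScheme (siff (box Φ) (neg (dia (neg Φ))))
  | m4 (Φ) : AxiomScheme (siff (dia Φ) (neg (box (neg Φ))))
  -- quantifiers
  | q1 (x : Var) (t : Term σ) (Φ) (h : FreeFor t x Φ) : AxiomScheme (imp (all x Φ) (subst1 Φ x t))
  | q2 (x : Var) (t : Term σ) (Φ) (h : FreeFor t x Φ) : AxiomScheme (imp (subst1 Φ x t) (ex x Φ))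
  | q3 (x : Var) (Φ) : AxiomScheme (iff (neg (all x Φ)) (ex x (neg Φ)))
  | q4 (x : Var) (Φ) : AxiomScheme (iff (neg (ex x Φ)) (all x (neg Φ)))

open Formula in
/-- The logic `QBK`: the least set of formulas that contains the axioms and is closed under modus
ponens, the two monotonicity rules and the two Bernays rules. -/
inductive Logic {σ : Signature.{u, v}} : Formula σ → Prop
  | ax {Φ} (h : AxiomScheme Φ) : Logic Φ
  | mp {Φ Ψ} (h₁ : Logic Φ) (h₂ : Logic (imp Φ Ψ)) : Logic Ψ
  | mb {Φ Ψ} (h : Logic (imp Φ Ψ)) : Logic (imp (box Φ) (box Ψ))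
  | md {Φ Ψ} (h : Logic (imp Φ Ψ)) : Logic (imp (dia Φ) (dia Ψ))
  | br1 {Φ Ψ} {x : Var} (hx : ¬ IsFree x Φ) (h : Logic (imp Φ Ψ)) : Logic (imp Φ (all x Ψ))
  | br2 {Φ Ψ} {x : Var} (hx : ¬ IsFree x Ψ) (h : Logic (imp Φ Ψ)) : Logic (imp (ex x Φ) Ψ)

open Formula in
/-- The formulas obtained from `Γ` and the theorems of `QBK` by modus ponens and the two Bernays
rules (the monotonicity rules are not available here). -/
inductive Derivable {σ : Signature.{u, v}} (Γ : Set (Formula σ)) : Formula σ → Prop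
  | hyp {Φ} (h : Φ ∈ Γ) : Derivable Γ Φ
  | thm {Φ} (h : Logic Φ) : Derivable Γ Φ
  | mp {Φ Ψ} (h₁ : Derivable Γ Φ) (h₂ : Derivable Γ (imp Φ Ψ)) : Derivable Γ Ψ
  | br1 {Φ Ψ} {x : Var} (hx : ¬ IsFree x Φ) (h : Derivable Γ (imp Φ Ψ)) :
      Derivable Γ (imp Φ (all x Ψ))
  | br2 {Φ Ψ} {x : Var} (hx : ¬ IsFree x Ψ) (h : Derivable Γ (imp Φ Ψ)) :
      Derivable Γ (imp (ex x Φ) Ψ)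

/-- `Γ ⊢ Δ`: some finite (possibly empty) disjunction of elements of `Δ` is derivable
from `Γ`. -/
def Proves {σ : Signature.{u, v}} (Γ Δ : Set (Formula σ)) : Prop :=
  ∃ l : List (Formula σ), (∀ Φ ∈ l, Φ ∈ Δ) ∧ Derivable Γ (Formula.disj l)

/-- A `σ`-structure whose carrier is a non-empty subset of the ambient type `D`. -/
structure Struct (σ : Signature.{u, v}) (D : Type w) where
  /-- the underlying set -/
  carrier : Set D
  nonempty : carrier.Nonempty
  /-- the interpretation of the constant symbols -/
  const : σ.Const → D
  const_mem : ∀ c, const c ∈ carrier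
  /-- the interpretation of the predicate symbols, relations on the carrier -/
  rel : (P : σ.Pred) → Set (Fin (σ.arity P) → D)
  rel_mem : ∀ P, ∀ a ∈ rel P, ∀ i, a i ∈ carrier

namespace Struct

variable {σ : Signature.{u, v}} {D : Type w}

/-- The term `t` denotes `d`: the new constant of an element denotes that element, and a variable
denotes nothing. -/
def Denotes (𝔄 : Struct σ D) : Term (σ.adjoin D) → D → Prop
  | .var _, _ => False
  | .const (Sum.inl c), d => 𝔄.const c = d
  | .const (Sum.inr a), d => a = d

/-- Truth of an atomic sentence with parameters from the carrier. -/
def SatAtom (𝔄 : Struct σ D) (P : σ.Pred) (ts : Fin (σ.arity P) → Term (σ.adjoin D)) : Prop :=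
  ∃ a ∈ 𝔄.rel P, ∀ i, 𝔄.Denotes (ts i) (a i)

end Struct

/-- `QBK`-models. All domains are subsets of one ambient type `D`, so that inclusions between them
make sense. -/
structure Model (σ : Signature.{u, v}) where
  /-- the worlds -/
  World : Type w
  world_nonempty : Nonempty World
  /-- the accessibility relation -/
  R : World → World → Prop
  /-- the ambient type of the domains -/
  D : Type w
  /-- the verification structures -/
  pos : World → Struct σ D
  /-- the falsification structures -/
  neg : World → Struct σ D
  carrier_eq : ∀ w, (pos w).carrier = (neg w).carrier
  const_eq : ∀ w c, (pos w).const c = (neg w).const c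
  carrier_mono : ∀ u v, R u v → (pos u).carrier ⊆ (pos v).carrier
  const_rigid : ∀ u v, R u v → ∀ c, (pos u).const c = (pos v).const c

/-- Verification and falsification. -/
inductive Polarity : Type
  | ver
  | fal

namespace Model

variable {σ : Signature.{u, v}}

/-- The domain of the world `w`. -/
def dom (M : Model.{u, v, w} σ) (w : M.World) : Set M.D := (M.pos w).carrier

/-- Verifiability and falsifiability of a sentence with parameters from `M.dom w` at the
world `w`. (On other formulas with parameters from `M.D` the value is irrelevant.) -/
def Forces (M : Model.{u, v, w} σ) : Polarity → M.World → Formula (σ.adjoin M.D) → Prop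
  | .ver, w, .atom P ts => (M.pos w).SatAtom P ts
  | .fal, w, .atom P ts => (M.neg w).SatAtom P ts
  | .ver, _, .bot => False
  | .fal, _, .bot => True
  | .ver, w, .and Φ Ψ => Forces M .ver w Φ ∧ Forces M .ver w Ψ
  | .fal, w, .and Φ Ψ => Forces M .fal w Φ ∨ Forces M .fal w Ψ
  | .ver, w, .or Φ Ψ => Forces M .ver w Φ ∨ Forces M .ver w Ψ
  | .fal, w, .or Φ Ψ => Forces M .fal w Φ ∧ Forces M .fal w Ψ
  | .ver, w, .imp Φ Ψ => ¬ Forces M .ver w Φ ∨ Forces M .ver w Ψ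
  | .fal, w, .imp Φ Ψ => Forces M .ver w Φ ∧ Forces M .fal w Ψ
  | .ver, w, .box Φ => ∀ u, M.R w u → Forces M .ver u Φ
  | .fal, w, .box Φ => ∃ u, M.R w u ∧ Forces M .fal u Φ
  | .ver, w, .dia Φ => ∃ u, M.R w u ∧ Forces M .ver u Φ
  | .fal, w, .dia Φ => ∀ u, M.R w u → Forces M .fal u Φ
  | .ver, w, .neg Φ => Forces M .fal w Φ
  | .fal, w, .neg Φ => Forces M .ver w Φ
  | .ver, w, .all x Φ => ∀ a ∈ M.dom w, Forces M .ver w (Φ.subst1 x (.const (Sum.inr a)))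
  | .fal, w, .all x Φ => ∃ a ∈ M.dom w, Forces M .fal w (Φ.subst1 x (.const (Sum.inr a)))
  | .ver, w, .ex x Φ => ∃ a ∈ M.dom w, Forces M .ver w (Φ.subst1 x (.const (Sum.inr a)))
  | .fal, w, .ex x Φ => ∀ a ∈ M.dom w, Forces M .fal w (Φ.subst1 x (.const (Sum.inr a)))
termination_by _ _ Φ => Φ.complexity
decreasing_by
  all_goals simp only [Formula.complexity, Formula.complexity_subst1]; omega

/-- `s` is a ground substitution over the signature `σ` enlarged by the domain of `w`. -/
def IsGround (M : Model.{u, v, w} σ) (w : M.World) (s : Var → Term (σ.adjoin M.D)) : Prop :=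
  ∀ x, (∃ c : σ.Const, s x = .const (Sum.inl c)) ∨ ∃ a ∈ M.dom w, s x = .const (Sum.inr a)

end Model

/-- `Γ ⊨ Δ`: semantic consequence over `QBK`-models with worlds and domains in `Type w`. -/
def Entails {σ : Signature.{u, v}} (Γ Δ : Set (Formula σ)) : Prop :=
  ∀ (M : Model.{u, v, w} σ) (w : M.World) (s : Var → Term (σ.adjoin M.D)), M.IsGround w s →
    (∀ Φ ∈ Γ, M.Forces .ver w (Φ.lift M.D)) →
      ∃ Ψ ∈ Δ, M.Forces .ver w ((Ψ.lift M.D).subst s)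

end QBK

/-! Soundness is an induction on derivations, carried out for `Sat`, a semantics by valuations that
agrees with the substitutional one (`forces_iff_sat`). Rigidity of constants and monotonicity of
domains make the modal cases work. The premises are sentences, so they stay true when a Bernays rule
changes the valuation.

Completeness is a Henkin argument with growing domains. It uses `Prv`, derivability by modus ponens
alone: the deduction theorem holds for it without side conditions, and generalization is admissible
over sentences (`Prv.gen`). The free variables of `Δ` are replaced by parameters. If `Γ` together
with the negations of the instances of `Δ` is inconsistent, then some disjunction of formulas of `Δ`
is derivable, because parameters can be turned back into variables (`Prv.of_ground`, `Prv.of_lift`).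
Otherwise this set extends to a complete Henkin theory, a world of the canonical model that refutes
the consequence.

Parameters carry a level, and a successor world uses exactly one level more than its predecessor.
Each successor thus has unused witnesses at its disposal, and no Barcan formula is needed. A
parameter also carries the code of the existential formula that it witnesses. Among finitely many
Henkin axioms, the one with the largest code has a witness foreign to the others, so adding all
axioms of a level preserves consistency (`consistent_henkinAxioms`), whatever the cardinality of the
signature.

In the truth lemma (`canonicalModel_sat_iff`) falsification of `Φ` corresponds to provability of
`∼Φ`. The axioms for strong negation push `∼` inward and reduce each falsification clause to a
positive one. -/

namespace QBK

/-! ### Substitution and free variables -/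

namespace Formula

variable {σ : Signature.{u, v}}

theorem subst_congr {s s' : Var → Term σ} {Φ : Formula σ} (h : ∀ x, IsFree x Φ → s x = s' x) :
    Φ.subst s = Φ.subst s' := by
  induction Φ generalizing s s' with
  | atom P ts =>
    simp only [subst]
    congr 1
    funext i
    cases hi : ts i with
    | var x => exact h x ⟨i, hi⟩
    | const c => rfl
  | bot => rfl
  | imp Φ Ψ ih₁ ih₂ | and Φ Ψ ih₁ ih₂ | or Φ Ψ ih₁ ih₂ =>
    simp only [subst]
    rw [ih₁ fun x hx => h x (Or.inl hx), ih₂ fun x hx => h x (Or.inr hx)]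
  | neg Φ ih | box Φ ih | dia Φ ih =>
    simp only [subst]
    rw [ih fun x hx => h x hx]
  | all y Φ ih | ex y Φ ih =>
    simp only [subst]
    rw [ih]
    intro x hx
    by_cases hxy : x = y
    · simp [hxy]
    · simp [hxy, h x ⟨hxy, hx⟩]

theorem subst_var (Φ : Formula σ) : Φ.subst Term.var = Φ := by
  induction Φ with
  | atom P ts =>
    simp only [subst]
    congr 1
    funext i
    cases ts i <;> rfl
  | _ => simp_all [subst]

theorem subst_eq_self {s : Var → Term σ} {Φ : Formula σ} (h : ∀ x, IsFree x Φ → s x = .var x) :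
    Φ.subst s = Φ :=
  (subst_congr h).trans (subst_var Φ)

theorem IsSentence.subst_eq {Φ : Formula σ} (h : Φ.IsSentence) (s : Var → Term σ) :
    Φ.subst s = Φ :=
  subst_eq_self fun x hx => absurd hx (h x)

theorem subst1_var (Φ : Formula σ) (x : Var) : Φ.subst1 x (.var x) = Φ := by
  simp [subst1, subst_var]

theorem freeFor_var (Φ : Formula σ) (x : Var) : FreeFor (.var x) x Φ := by
  induction Φ with
  | all y Φ ih | ex y Φ ih =>
    intro h
    exact ⟨fun hxy => h.1 (Term.var.inj hxy), ih⟩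
  | _ => simp_all [FreeFor]

theorem freeFor_const (Φ : Formula σ) (x : Var) (c : σ.Const) : FreeFor (.const c) x Φ := by
  induction Φ <;> simp_all [FreeFor]

/-- Composition of substitutions, when the first one introduces no variables that the second one
changes in the scope of a quantifier. -/
theorem subst_subst {s s' s'' : Var → Term σ} {Φ : Formula σ}
    (h : ∀ x, (s x).subst s' = s'' x)
    (hs : ∀ x, s x = .var x ∨ ∃ c, s x = .const c) :
    (Φ.subst s).subst s' = Φ.subst s'' := by
  induction Φ generalizing s s' s'' with
  | atom P ts =>
    simp only [subst]
    congr 1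
    funext i
    cases ts i with
    | var x => exact h x
    | const c => rfl
  | bot => rfl
  | imp Φ Ψ ih₁ ih₂ | and Φ Ψ ih₁ ih₂ | or Φ Ψ ih₁ ih₂ =>
    simp only [subst]
    rw [ih₁ h hs, ih₂ h hs]
  | neg Φ ih | box Φ ih | dia Φ ih =>
    simp only [subst]
    rw [ih h hs]
  | all y Φ ih | ex y Φ ih =>
    simp only [subst]
    rw [ih (s'' := Function.update s'' y (.var y))]
    · intro x
      by_cases hxy : x = y
      · simp [hxy, Term.subst]
      · rcases hs x with hx | ⟨c, hx⟩
        · have := h x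
          simp [hxy, hx, Term.subst] at this ⊢
          exact this
        · have := h x
          simp [hxy, hx, Term.subst] at this ⊢
          exact this
    · intro x
      by_cases hxy : x = y
      · simp [hxy]
      · simpa [hxy] using hs x

/-- Instantiating the variable of a quantifier after a ground substitution. -/
theorem subst_update_subst1 {s : Var → Term σ} (hs : ∀ x, ∃ c, s x = .const c) (Φ : Formula σ)
    (x : Var) (t : Term σ) :
    (Φ.subst (Function.update s x (.var x))).subst1 x t = Φ.subst (Function.update s x t) := by
  apply subst_subst
  · intro y
    by_cases hxy : y = x
    · simp [hxy, Term.subst]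
    · obtain ⟨c, hc⟩ := hs y
      simp [hxy, hc, Term.subst]
  · intro y
    by_cases hxy : y = x
    · simp [hxy]
    · simpa [hxy] using Or.inr (hs y)

theorem exists_of_isFree_subst {s : Var → Term σ} {Φ : Formula σ} {x : Var}
    (h : IsFree x (Φ.subst s)) : ∃ y, IsFree y Φ ∧ s y = .var x := by
  induction Φ generalizing s with
  | atom P ts =>
    obtain ⟨i, hi⟩ := h
    cases ht : ts i with
    | const c => simp [ht, Term.subst] at hi
    | var y => exact ⟨y, ⟨i, ht⟩, by simpa [ht, Term.subst] using hi⟩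
  | bot => exact h.elim
  | imp Φ Ψ ih₁ ih₂ | and Φ Ψ ih₁ ih₂ | or Φ Ψ ih₁ ih₂ =>
    rcases h with h | h
    · exact (ih₁ h).imp fun y hy => ⟨Or.inl hy.1, hy.2⟩
    · exact (ih₂ h).imp fun y hy => ⟨Or.inr hy.1, hy.2⟩
  | neg Φ ih | box Φ ih | dia Φ ih => exact ih h
  | all z Φ ih | ex z Φ ih =>
    obtain ⟨hxz, h⟩ := h
    obtain ⟨y, hy, hs⟩ := ih h
    by_cases hyz : y = z
    · subst hyz
      simp only [Function.update_self, Term.var.injEq] at hs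
      exact absurd hs.symm hxz
    · exact ⟨y, ⟨hyz, hy⟩, by simpa [hyz] using hs⟩

theorem isSentence_subst_const {K : Var → σ.Const} (Φ : Formula σ) :
    (Φ.subst fun x => .const (K x)).IsSentence := fun x h => by
  obtain ⟨y, -, hy⟩ := exists_of_isFree_subst h
  cases hy

theorem isFree_lift {A : Type w} {Φ : Formula σ} {x : Var} :
    IsFree x (Φ.lift A) ↔ IsFree x Φ := by
  induction Φ with
  | atom P ts =>
    simp only [lift, IsFree]
    refine exists_congr fun i => ?_
    cases ts i <;> simp [Term.lift]
  | _ => simp_all [lift, IsFree]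

end Formula

/-! ### Semantics by valuations -/

namespace Term

variable {σ : Signature.{u, v}} {D : Type w}

/-- The value of a term under an interpretation of the constants and a valuation. -/
def eval (k : σ.Const → D) (e : Var → D) : Term σ → D
  | .var x => e x
  | .const c => k c

end Term

namespace Model

variable {σ : Signature.{u, v}} (M : Model.{u, v, w} σ)

/-- The structure of a world that belongs to a polarity. -/
def struct : Polarity → M.World → Struct σ M.D
  | .ver => M.pos
  | .fal => M.neg

/-- Verification and falsification of a formula under a valuation of the variables. -/
def Sat : Formula σ → Polarity → M.World → (Var → M.D) → Prop
  | .atom P ts, p, w, e => (fun i => (ts i).eval (M.pos w).const e) ∈ (M.struct p w).rel P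
  | .bot, .ver, _, _ => False
  | .bot, .fal, _, _ => True
  | .and Φ Ψ, .ver, w, e => Sat Φ .ver w e ∧ Sat Ψ .ver w e
  | .and Φ Ψ, .fal, w, e => Sat Φ .fal w e ∨ Sat Ψ .fal w e
  | .or Φ Ψ, .ver, w, e => Sat Φ .ver w e ∨ Sat Ψ .ver w e
  | .or Φ Ψ, .fal, w, e => Sat Φ .fal w e ∧ Sat Ψ .fal w e
  | .imp Φ Ψ, .ver, w, e => ¬ Sat Φ .ver w e ∨ Sat Ψ .ver w e
  | .imp Φ Ψ, .fal, w, e => Sat Φ .ver w e ∧ Sat Ψ .fal w e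
  | .box Φ, .ver, w, e => ∀ u, M.R w u → Sat Φ .ver u e
  | .box Φ, .fal, w, e => ∃ u, M.R w u ∧ Sat Φ .fal u e
  | .dia Φ, .ver, w, e => ∃ u, M.R w u ∧ Sat Φ .ver u e
  | .dia Φ, .fal, w, e => ∀ u, M.R w u → Sat Φ .fal u e
  | .neg Φ, .ver, w, e => Sat Φ .fal w e
  | .neg Φ, .fal, w, e => Sat Φ .ver w e
  | .all x Φ, .ver, w, e => ∀ a ∈ M.dom w, Sat Φ .ver w (Function.update e x a)
  | .all x Φ, .fal, w, e => ∃ a ∈ M.dom w, Sat Φ .fal w (Function.update e x a)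
  | .ex x Φ, .ver, w, e => ∃ a ∈ M.dom w, Sat Φ .ver w (Function.update e x a)
  | .ex x Φ, .fal, w, e => ∀ a ∈ M.dom w, Sat Φ .fal w (Function.update e x a)

/-- The substitution `s` replaces every variable by a constant that denotes its value. -/
def Represents (w : M.World) (s : Var → Term (σ.adjoin M.D)) (e : Var → M.D) : Prop :=
  ∀ x, (∃ c : σ.Const, s x = .const (Sum.inl c) ∧ (M.pos w).const c = e x) ∨
    s x = .const (Sum.inr (e x))

variable {M}

theorem Represents.mono {w u : M.World} (hR : M.R w u) {s : Var → Term (σ.adjoin M.D)}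
    {e : Var → M.D} (h : M.Represents w s e) : M.Represents u s e := fun x =>
  (h x).imp_left fun ⟨c, hc, hc'⟩ => ⟨c, hc, (M.const_rigid w u hR c) ▸ hc'⟩

theorem Represents.update {w : M.World} {s : Var → Term (σ.adjoin M.D)} {e : Var → M.D}
    (h : M.Represents w s e) (x : Var) (a : M.D) :
    M.Represents w (Function.update s x (.const (Sum.inr a))) (Function.update e x a) := by
  intro y
  by_cases hy : y = x
  · subst hy; simp
  · simpa [hy] using h y

theorem Represents.ground {w : M.World} {s : Var → Term (σ.adjoin M.D)} {e : Var → M.D}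
    (h : M.Represents w s e) (x : Var) : ∃ c, s x = .const c := by
  rcases h x with ⟨c, hc, -⟩ | hc
  exacts [⟨_, hc⟩, ⟨_, hc⟩]

theorem Represents.denotes_iff {w : M.World} {s : Var → Term (σ.adjoin M.D)} {e : Var → M.D}
    (h : M.Represents w s e) (p : Polarity) (t : Term σ) (d : M.D) :
    (M.struct p w).Denotes ((t.lift M.D).subst s) d ↔ t.eval (M.pos w).const e = d := by
  have hp : ∀ c, (M.struct p w).const c = (M.pos w).const c := by
    cases p
    · exact fun _ => rfl
    · exact fun c => (M.const_eq w c).symm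
  cases t with
  | const c => simp [Term.lift, Term.subst, Struct.Denotes, Term.eval, hp]
  | var x =>
    rcases h x with ⟨c, hc, hc'⟩ | hc
    · simp [Term.lift, Term.subst, Struct.Denotes, Term.eval, hc, hp, hc']
    · simp [Term.lift, Term.subst, Struct.Denotes, Term.eval, hc]

/-- Ground substitutions can be traded for valuations. The modal cases rest on rigidity: a
substitution that represents `e` at a world still represents it at every successor. -/
theorem forces_iff_sat {w : M.World} {s : Var → Term (σ.adjoin M.D)} {e : Var → M.D}
    (h : M.Represents w s e) (p : Polarity) (Φ : Formula σ) :
    M.Forces p w ((Φ.lift M.D).subst s) ↔ M.Sat Φ p w e := by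
  induction Φ generalizing p w s e with
  | atom P ts =>
    have key : (M.struct p w).SatAtom P (fun i => ((ts i).lift M.D).subst s) ↔
        M.Sat (.atom P ts) p w e := by
      simp only [Struct.SatAtom, h.denotes_iff, Sat]
      constructor
      · rintro ⟨a, ha, hi⟩
        rwa [show (fun i => (ts i).eval (M.pos w).const e) = a from funext hi]
      · exact fun ha => ⟨_, ha, fun _ => rfl⟩
    cases p <;> simp only [Formula.lift, Formula.subst, Forces] <;> exact key
  | bot => cases p <;> simp [Formula.lift, Formula.subst, Forces, Sat]
  | imp Φ Ψ ih₁ ih₂ | and Φ Ψ ih₁ ih₂ | or Φ Ψ ih₁ ih₂ =>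
    cases p <;> simp [Formula.lift, Formula.subst, Forces, Sat, ih₁ h, ih₂ h]
  | neg Φ ih => cases p <;> simp [Formula.lift, Formula.subst, Forces, Sat, ih h]
  | box Φ ih | dia Φ ih =>
    cases p <;> simp only [Formula.lift, Formula.subst, Forces, Sat]
    all_goals
      first
        | exact forall_congr' fun u => forall_congr' fun hu => ih (h.mono hu) _
        | exact exists_congr fun u => and_congr_right fun hu => ih (h.mono hu) _
  | all x Φ ih | ex x Φ ih =>
    cases p <;> simp only [Formula.lift, Formula.subst, Forces, Sat,
      Formula.subst_update_subst1 h.ground, ih (h.update x _)]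

theorem Sat.congr {Φ : Formula σ} {p : Polarity} {w : M.World} {e e' : Var → M.D}
    (h : ∀ x, Φ.IsFree x → e x = e' x) : M.Sat Φ p w e ↔ M.Sat Φ p w e' := by
  induction Φ generalizing p w e e' with
  | atom P ts =>
    have : (fun i => (ts i).eval (M.pos w).const e) =
        fun i => (ts i).eval (M.pos w).const e' := by
      funext i
      cases hi : ts i with
      | var x => exact h x ⟨i, hi⟩
      | const c => rfl
    cases p <;> simp only [Sat, this]
  | bot => cases p <;> simp [Sat]
  | imp Φ Ψ ih₁ ih₂ | and Φ Ψ ih₁ ih₂ | or Φ Ψ ih₁ ih₂ =>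
    have h₁ := fun p => @ih₁ p w e e' fun x hx => h x (Or.inl hx)
    have h₂ := fun p => @ih₂ p w e e' fun x hx => h x (Or.inr hx)
    cases p <;> simp [Sat, h₁, h₂]
  | neg Φ ih | box Φ ih | dia Φ ih =>
    have h₁ := fun p w => @ih p w e e' h
    cases p <;> simp [Sat, h₁]
  | all x Φ ih | ex x Φ ih =>
    have h₁ := fun p a => @ih p w (Function.update e x a) (Function.update e' x a) (by
      intro y hy
      by_cases hyx : y = x
      · simp [hyx]
      · simpa [hyx] using h y ⟨hyx, hy⟩)
    cases p <;> simp [Sat, h₁]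

theorem sat_update_of_not_isFree {Φ : Formula σ} {x : Var} (hx : ¬ Φ.IsFree x) {p : Polarity}
    {w : M.World} {e : Var → M.D} (a : M.D) :
    M.Sat Φ p w (Function.update e x a) ↔ M.Sat Φ p w e :=
  Sat.congr fun y hy => Function.update_of_ne (fun h : y = x => hx (h ▸ hy)) _ _

theorem sat_subst1 {Φ : Formula σ} {x : Var} {t : Term σ} (h : Φ.FreeFor t x) {p : Polarity}
    {w : M.World} {e : Var → M.D} :
    M.Sat (Φ.subst1 x t) p w e ↔
      M.Sat Φ p w (Function.update e x (t.eval (M.pos w).const e)) := by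
  induction Φ generalizing p w e with
  | atom P ts =>
    have : (fun i => ((ts i).subst (Function.update Term.var x t)).eval (M.pos w).const e) =
        fun i => (ts i).eval (M.pos w).const
          (Function.update e x (t.eval (M.pos w).const e)) := by
      funext i
      cases ts i with
      | var y =>
        by_cases hy : y = x
        · subst hy; simp [Term.subst, Term.eval]
        · simp [Term.subst, Term.eval, hy]
      | const c => rfl
    simp only [Formula.subst1, Formula.subst, Sat, this]
  | bot => cases p <;> simp [Sat, Formula.subst1, Formula.subst]
  | imp Φ Ψ ih₁ ih₂ | and Φ Ψ ih₁ ih₂ | or Φ Ψ ih₁ ih₂ =>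
    simp only [Formula.subst1] at ih₁ ih₂
    cases p <;> simp [Sat, Formula.subst1, Formula.subst, ih₁ h.1, ih₂ h.2]
  | neg Φ ih =>
    simp only [Formula.subst1] at ih
    cases p <;> simp [Sat, Formula.subst1, Formula.subst, ih h]
  | box Φ ih | dia Φ ih =>
    have key : ∀ p u, M.R w u → (M.Sat (Φ.subst (Function.update Term.var x t)) p u e ↔
        M.Sat Φ p u (Function.update e x (t.eval (M.pos w).const e))) := by
      intro p u hu
      -- Rigidity: `t` has the same value at the successor `u`.
      rw [show t.eval (M.pos w).const e = t.eval (M.pos u).const e by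
        cases t with
        | var y => rfl
        | const c => exact M.const_rigid w u hu c]
      exact ih h
    cases p <;> simp only [Formula.subst1, Formula.subst, Sat]
    all_goals
      first
        | exact forall_congr' fun u => forall_congr' fun hu => key _ u hu
        | exact exists_congr fun u => and_congr_right fun hu => key _ u hu
  | all y Φ ih | ex y Φ ih =>
    have key : ∀ a, M.Sat (Φ.subst (Function.update (Function.update Term.var x t) y (.var y)))
        p w (Function.update e y a) ↔
        M.Sat Φ p w (Function.update
          (Function.update e x (t.eval (M.pos w).const e)) y a) := by
      intro a
      -- If `y = x`, the quantifier shields `x`. If `x` is free in `Φ`, then `t` is not the variable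
      -- `y`, and the two updates commute. Otherwise the substitution and the update at `x` have no
      -- effect.
      by_cases hyx : y = x
      · subst hyx
        simp [Formula.subst_var]
      · by_cases hx : Φ.IsFree x
        · obtain ⟨hty, ht⟩ := h ⟨fun h => hyx h.symm, hx⟩
          rw [Function.update_comm (Ne.symm hyx), Function.update_comm (Ne.symm hyx),
            Function.update_eq_self]
          have : t.eval (M.pos w).const e =
              t.eval (M.pos w).const (Function.update e y a) := by
            cases t with
            | const c => rfl
            | var z =>
              have : z ≠ y := fun h => hty (h ▸ rfl)
              simp [Term.eval, this]
          rw [this]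
          exact ih ht
        · rw [Formula.subst_eq_self]
          · apply Sat.congr
            intro z hz
            have hzx : z ≠ x := fun h => hx (h ▸ hz)
            by_cases hzy : z = y
            · simp [hzy]
            · simp [hzy, hzx]
          · intro z hz
            have hzx : z ≠ x := fun h => hx (h ▸ hz)
            by_cases hzy : z = y
            · simp [hzy]
            · simp [hzy, hzx]
    cases p <;> simp only [Formula.subst1, Formula.subst, Sat, key]

end Model

/-! ### Soundness -/

section Soundness

variable {σ : Signature.{u, v}} {M : Model.{u, v, w} σ}

theorem Term.eval_mem {w : M.World} {e : Var → M.D} (he : ∀ x, e x ∈ M.dom w) (t : Term σ) :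
    t.eval (M.pos w).const e ∈ M.dom w := by
  cases t with
  | var x => exact he x
  | const c => exact (M.pos w).const_mem c

theorem AxiomScheme.sound {Φ : Formula σ} (h : AxiomScheme Φ) (w : M.World) {e : Var → M.D}
    (he : ∀ x, e x ∈ M.dom w) : M.Sat Φ .ver w e := by
  cases h with
  | q1 x t Φ h =>
    simp only [Model.Sat, Model.sat_subst1 h, ← imp_iff_not_or]
    exact fun H => H _ (t.eval_mem he)
  | q2 x t Φ h =>
    simp only [Model.Sat, Model.sat_subst1 h, ← imp_iff_not_or]
    exact fun H => ⟨_, t.eval_mem he, H⟩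
  | _ =>
    simp only [Formula.iff, Formula.siff, Formula.cneg, Model.Sat, ← imp_iff_not_or] <;> grind

/-- The world varies in the induction because the monotonicity rules pass to successors; growing
domains keep the valuation admissible there. -/
theorem Logic.sound {Φ : Formula σ} (h : Logic Φ) (w : M.World) {e : Var → M.D}
    (he : ∀ x, e x ∈ M.dom w) : M.Sat Φ .ver w e := by
  induction h generalizing w e with
  | ax h => exact h.sound w he
  | mp _ _ ih₁ ih₂ => exact (ih₂ w he).resolve_left (not_not_intro (ih₁ w he))
  | mb _ ih =>
    simp only [Model.Sat, ← imp_iff_not_or] at ih ⊢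
    exact fun H u hu => ih u (fun x => M.carrier_mono w u hu (he x)) (H u hu)
  | md _ ih =>
    simp only [Model.Sat, ← imp_iff_not_or] at ih ⊢
    exact fun ⟨u, hu, H⟩ => ⟨u, hu, ih u (fun x => M.carrier_mono w u hu (he x)) H⟩
  | br1 hx _ ih =>
    simp only [Model.Sat, ← imp_iff_not_or] at ih ⊢
    intro H a ha
    exact ih w (Function.forall_update_iff e (fun _ b => b ∈ M.dom w) |>.2 ⟨ha, fun y _ => he y⟩)
      ((Model.sat_update_of_not_isFree hx a).2 H)
  | br2 hx _ ih =>
    simp only [Model.Sat, ← imp_iff_not_or] at ih ⊢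
    rintro ⟨a, ha, H⟩
    exact (Model.sat_update_of_not_isFree hx a).1
      (ih w (Function.forall_update_iff e (fun _ b => b ∈ M.dom w) |>.2 ⟨ha, fun y _ => he y⟩) H)

/-- The world is fixed, since no modal rule applies to premises, but the premises must hold under
all valuations in its domain, since the Bernays rules change the valuation. -/
theorem Derivable.sound {Γ : Set (Formula σ)} {Φ : Formula σ} (h : Derivable Γ Φ) (w : M.World)
    (hΓ : ∀ Φ ∈ Γ, ∀ e : Var → M.D, (∀ x, e x ∈ M.dom w) → M.Sat Φ .ver w e)
    {e : Var → M.D} (he : ∀ x, e x ∈ M.dom w) : M.Sat Φ .ver w e := by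
  induction h generalizing e with
  | hyp h => exact hΓ _ h e he
  | thm h => exact h.sound w he
  | mp _ _ ih₁ ih₂ => exact (ih₂ he).resolve_left (not_not_intro (ih₁ he))
  | br1 hx _ ih =>
    simp only [Model.Sat, ← imp_iff_not_or] at ih ⊢
    intro H a ha
    exact ih (Function.forall_update_iff e (fun _ b => b ∈ M.dom w) |>.2 ⟨ha, fun y _ => he y⟩)
      ((Model.sat_update_of_not_isFree hx a).2 H)
  | br2 hx _ ih =>
    simp only [Model.Sat, ← imp_iff_not_or] at ih ⊢
    rintro ⟨a, ha, H⟩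
    exact (Model.sat_update_of_not_isFree hx a).1
      (ih (Function.forall_update_iff e (fun _ b => b ∈ M.dom w) |>.2 ⟨ha, fun y _ => he y⟩) H)

theorem Model.sat_disj {l : List (Formula σ)} {w : M.World} {e : Var → M.D} :
    M.Sat (Formula.disj l) .ver w e ↔ ∃ Φ ∈ l, M.Sat Φ .ver w e := by
  induction l with
  | nil => simp [Formula.disj, Sat]
  | cons Φ l ih =>
    cases l with
    | nil => simp [Formula.disj]
    | cons Ψ l =>
      rw [List.exists_mem_cons_iff, ← ih]
      simp only [Formula.disj, Sat]

theorem Model.exists_represents {w : M.World} {s : Var → Term (σ.adjoin M.D)}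
    (hs : M.IsGround w s) : ∃ e, M.Represents w s e ∧ ∀ x, e x ∈ M.dom w := by
  have : ∀ x, ∃ d ∈ M.dom w, (∃ c : σ.Const, s x = .const (Sum.inl c) ∧ (M.pos w).const c = d) ∨
      s x = .const (Sum.inr d) := by
    intro x
    rcases hs x with ⟨c, hc⟩ | ⟨a, ha, hc⟩
    · exact ⟨_, (M.pos w).const_mem c, Or.inl ⟨c, hc, rfl⟩⟩
    · exact ⟨a, ha, Or.inr hc⟩
  choose e he hse using this
  exact ⟨e, hse, he⟩

theorem Model.forces_lift_iff {Φ : Formula σ} (hΦ : Φ.IsSentence) {w : M.World}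
    (e : Var → M.D) : M.Forces .ver w (Φ.lift M.D) ↔ M.Sat Φ .ver w e := by
  rw [← forces_iff_sat (s := fun x => .const (Sum.inr (e x))) (fun x => Or.inr rfl),
    Formula.IsSentence.subst_eq fun x hx => hΦ x (Formula.isFree_lift.1 hx)]

theorem Proves.entails {Γ Δ : Set (Formula σ)} (hΓ : ∀ Φ ∈ Γ, Φ.IsSentence)
    (h : Proves Γ Δ) : Entails.{u, v, w} Γ Δ := by
  intro M w s hs hw
  obtain ⟨l, hl, hd⟩ := h
  obtain ⟨e, hse, he⟩ := Model.exists_represents hs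
  obtain ⟨Ψ, hΨ, hsat⟩ := Model.sat_disj.1 (hd.sound w
    (fun Φ hΦ e _ => (Model.forces_lift_iff (hΓ Φ hΦ) e).1 (hw Φ hΦ)) he)
  exact ⟨Ψ, hl Ψ hΨ, (Model.forces_iff_sat hse .ver Ψ).2 hsat⟩

end Soundness

end QBK

namespace QBK

/-! ### Derivability by modus ponens -/

section LocalDerivability

variable {σ : Signature.{u, v}}

open Formula

/-- Derivability from hypotheses and theorems of `QBK` by modus ponens alone. -/
inductive Prv (Γ : Set (Formula σ)) : Formula σ → Prop
  | hyp {Φ} (h : Φ ∈ Γ) : Prv Γ Φ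
  | thm {Φ} (h : Logic Φ) : Prv Γ Φ
  | mp {Φ Ψ} (h₁ : Prv Γ Φ) (h₂ : Prv Γ (imp Φ Ψ)) : Prv Γ Ψ

namespace Prv

variable {Γ Γ' : Set (Formula σ)} {Φ Ψ Θ : Formula σ}

theorem ax (h : AxiomScheme Φ) : Prv Γ Φ := thm (.ax h)

theorem derivable (h : Prv Γ Φ) : Derivable Γ Φ := by
  induction h with
  | hyp h => exact .hyp h
  | thm h => exact .thm h
  | mp _ _ ih₁ ih₂ => exact .mp ih₁ ih₂

theorem mono (h : Γ ⊆ Γ') (hp : Prv Γ Φ) : Prv Γ' Φ := by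
  induction hp with
  | hyp hm => exact hyp (h hm)
  | thm hm => exact thm hm
  | mp _ _ ih₁ ih₂ => exact ih₁.mp ih₂

theorem logic (h : Prv ∅ Φ) : Logic Φ := by
  induction h with
  | hyp h => exact h.elim
  | thm h => exact h
  | mp _ _ ih₁ ih₂ => exact .mp ih₁ ih₂

theorem weaken (h : Prv Γ Φ) : Prv (insert Ψ Γ) Φ := h.mono (Set.subset_insert _ _)

theorem head : Prv (insert Φ Γ) Φ := hyp (Set.mem_insert _ _)

theorem const_imp (h : Prv Γ Φ) : Prv Γ (imp Ψ Φ) := h.mp (ax (.i1 _ _))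

theorem imp_self : Prv Γ (imp Φ Φ) :=
  (ax (.i1 Φ Φ)).mp ((ax (.i1 Φ (imp Φ Φ))).mp (ax (.i2 _ _ _)))

/-- The deduction theorem needs no condition on free variables because `Prv` has no quantifier
rules. -/
theorem intro (h : Prv (insert Φ Γ) Ψ) : Prv Γ (imp Φ Ψ) := by
  induction h with
  | hyp h =>
    rcases h with rfl | h
    · exact imp_self
    · exact (hyp h).const_imp
  | thm h => exact (thm h).const_imp
  | mp _ _ ih₁ ih₂ => exact ih₁.mp (ih₂.mp (ax (.i2 _ _ _)))

theorem and_intro (h₁ : Prv Γ Φ) (h₂ : Prv Γ Ψ) : Prv Γ (and Φ Ψ) := h₂.mp (h₁.mp (ax (.c3 _ _)))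

theorem left (h : Prv Γ (and Φ Ψ)) : Prv Γ Φ := h.mp (ax (.c1 _ _))

theorem right (h : Prv Γ (and Φ Ψ)) : Prv Γ Ψ := h.mp (ax (.c2 _ _))

theorem inl (h : Prv Γ Φ) : Prv Γ (or Φ Ψ) := h.mp (ax (.d1 _ _))

theorem inr (h : Prv Γ Ψ) : Prv Γ (or Φ Ψ) := h.mp (ax (.d2 _ _))

theorem cases (h : Prv Γ (or Φ Ψ)) (h₁ : Prv Γ (imp Φ Θ)) (h₂ : Prv Γ (imp Ψ Θ)) : Prv Γ Θ :=
  h.mp (h₂.mp (h₁.mp (ax (.d3 _ _ _))))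

theorem exfalso (h : Prv Γ bot) : Prv Γ Φ := h.mp (ax (.n2 _))

theorem by_contra (h : Prv (insert (cneg Φ) Γ) bot) : Prv Γ Φ :=
  (ax (.n1 Φ)).cases imp_self (intro h.exfalso)

end Prv

variable {Φ Ψ Θ : Formula σ}

theorem Logic.of_imp (h : ∀ Γ, Prv Γ Φ → Prv Γ Ψ) : Logic (imp Φ Ψ) :=
  Prv.logic (.intro (h _ .head))

theorem Logic.necessitation (h : Logic Φ) : Logic (box Φ) :=
  .mp (.ax (.k2 bot)) (.mb (.of_imp fun _ _ => .thm h))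

theorem Logic.gen (h : Logic Φ) (x : Var) : Logic (all x Φ) :=
  .mp (Prv.logic .imp_self) (.br1 (Φ := imp bot bot) (by simp [IsFree])
    (.of_imp fun _ _ => .thm h))

namespace Prv

variable {Γ : Set (Formula σ)}

theorem instantiate {x : Var} {t : Term σ} (ht : FreeFor t x Φ) (h : Prv Γ (all x Φ)) :
    Prv Γ (Φ.subst1 x t) :=
  h.mp (ax (.q1 x t Φ ht))

theorem instantiate_var {x : Var} (h : Prv Γ (all x Φ)) : Prv Γ Φ := by
  have := h.instantiate (freeFor_var Φ x)
  rwa [subst1_var] at this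

theorem all_mp {x : Var} (h₁ : Prv Γ (all x Φ)) (h₂ : Prv Γ (all x (imp Φ Ψ))) :
    Prv Γ (all x Ψ) :=
  (h₁.and_intro h₂).mp (thm (.br1 (by simp [IsFree])
    (.of_imp fun _ h => h.left.instantiate_var.mp h.right.instantiate_var)))

/-- A premise is a sentence, so the first Bernays rule applied to `Φ → Φ` generalizes it; the
quantifier then distributes over modus ponens. -/
theorem gen (hΓ : ∀ Φ ∈ Γ, Φ.IsSentence) (h : Prv Γ Φ) (x : Var) : Prv Γ (all x Φ) := by
  induction h with
  | hyp h => exact (hyp h).mp (thm (.br1 (hΓ _ h x) (.of_imp fun _ => id)))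
  | thm h => exact thm (h.gen x)
  | mp _ _ ih₁ ih₂ => exact ih₁.all_mp ih₂

theorem box_mp (h₁ : Prv Γ (box Φ)) (h₂ : Prv Γ (box (imp Φ Ψ))) : Prv Γ (box Ψ) :=
  ((h₁.and_intro h₂).mp (ax (.k1 _ _))).mp
    (thm (.mb (.of_imp fun _ h => h.left.mp h.right)))

theorem box (h : Prv Γ Φ) : Prv (box '' Γ) (box Φ) := by
  induction h with
  | hyp h => exact hyp ⟨_, h, rfl⟩
  | thm h => exact thm h.necessitation
  | mp _ _ ih₁ ih₂ => exact ih₁.box_mp ih₂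

/-- A universally refuted formula has no instance. -/
theorem not_ex_of_all_not {x : Var} (h : Prv Γ (all x (cneg Φ))) : Prv Γ (cneg (ex x Φ)) := by
  have : Logic (imp (ex x Φ) (cneg (all x (cneg Φ)))) := by
    refine .br2 (by simp [cneg, IsFree]) (Prv.logic (intro (intro ?_)))
    exact head.weaken.mp (Prv.head.instantiate_var)
  exact intro (h.weaken.mp (head.mp (thm this)))

theorem all_of_not_ex_not {x : Var} (h : Prv Γ (cneg (ex x (cneg Φ)))) : Prv Γ (all x Φ) := by
  have : Logic (imp (cneg (ex x (cneg Φ))) (all x Φ)) := by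
    refine .br1 (by simp [cneg, IsFree]) (Prv.logic (intro (by_contra ?_)))
    refine Prv.mp ?_ (head.weaken)
    have := ax (Γ := insert (cneg Φ) (insert (cneg (ex x (cneg Φ))) ∅))
      (.q2 x (.var x) (cneg Φ) (freeFor_var _ _))
    rw [subst1_var] at this
    exact head.mp this
  exact h.mp (thm this)

/-- Finitely many hypotheses of the form `F i` are used. -/
theorem exists_finset {ι : Type*} {F : ι → Formula σ} {S : Set ι}
    (h : Prv (Γ ∪ F '' S) Φ) : ∃ s : Finset ι, ↑s ⊆ S ∧ Prv (Γ ∪ F '' s) Φ := by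
  classical
  induction h with
  | hyp h =>
    rcases h with h | ⟨i, hi, rfl⟩
    · exact ⟨∅, by simp, hyp (Or.inl h)⟩
    · exact ⟨{i}, by simpa using hi, hyp (Or.inr ⟨i, by simp, rfl⟩)⟩
  | thm h => exact ⟨∅, by simp, thm h⟩
  | mp _ _ ih₁ ih₂ =>
    obtain ⟨s, hs, h₁⟩ := ih₁
    obtain ⟨t, ht, h₂⟩ := ih₂
    refine ⟨s ∪ t, by simp [hs, ht], ?_⟩
    refine (h₁.mono ?_).mp (h₂.mono ?_) <;>
    exact Set.union_subset_union_right _ (Set.image_mono (by simp))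

/-- Derivations are finite, so consistency passes to unions of chains, as Zorn's lemma requires. -/
theorem exists_mem_of_directedOn {C : Set (Set (Formula σ))} (hC : DirectedOn (· ⊆ ·) C)
    (hne : C.Nonempty) (h : Prv (⋃₀ C) Φ) : ∃ Γ ∈ C, Prv Γ Φ := by
  induction h with
  | hyp h =>
    obtain ⟨Γ, hΓ, h⟩ := h
    exact ⟨Γ, hΓ, hyp h⟩
  | thm h =>
    obtain ⟨Γ, hΓ⟩ := hne
    exact ⟨Γ, hΓ, thm h⟩
  | mp _ _ ih₁ ih₂ =>
    obtain ⟨Γ₁, hΓ₁, h₁⟩ := ih₁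
    obtain ⟨Γ₂, hΓ₂, h₂⟩ := ih₂
    obtain ⟨Γ, hΓ, h, h'⟩ := hC _ hΓ₁ _ hΓ₂
    exact ⟨Γ, hΓ, (h₁.mono h).mp (h₂.mono h')⟩

theorem disj_of_mem {l : List (Formula σ)} (h : Φ ∈ l) (hp : Prv Γ Φ) : Prv Γ (disj l) := by
  induction l with
  | nil => simp at h
  | cons Ψ l ih =>
    cases l with
    | nil =>
      obtain rfl : Φ = Ψ := by simpa using h
      exact hp
    | cons Θ l =>
      rcases List.mem_cons.1 h with rfl | h
      · exact hp.inl
      · exact (ih h).inr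

theorem disj_elim {l : List (Formula σ)} (h : ∀ Φ ∈ l, Prv Γ (imp Φ Ψ)) :
    Prv Γ (imp (disj l) Ψ) := by
  induction l with
  | nil => exact ax (.n2 _)
  | cons Φ l ih =>
    cases l with
    | nil => exact h Φ (by simp)
    | cons Θ l =>
      exact intro (head.cases (h Φ (by simp)).weaken
        (ih fun Φ hΦ => h Φ (List.mem_cons_of_mem _ hΦ)).weaken)

theorem disj_append_left {l l' : List (Formula σ)} (h : Prv Γ (disj l)) : Prv Γ (disj (l ++ l')) :=
  h.mp (disj_elim fun _ hΦ => intro (disj_of_mem (List.mem_append_left _ hΦ) head))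

theorem disj_append_right {l l' : List (Formula σ)} (h : Prv Γ (disj l')) :
    Prv Γ (disj (l ++ l')) :=
  h.mp (disj_elim fun _ hΦ => intro (disj_of_mem (List.mem_append_right _ hΦ) head))

/-- Negated hypotheses can be moved into a disjunctive conclusion. -/
theorem exists_disj {ι : Type*} {F : ι → Formula σ} {S : Set ι}
    (h : Prv (Γ ∪ (fun i => cneg (F i)) '' S) Φ) :
    ∃ l : List ι, (∀ i ∈ l, i ∈ S) ∧ Prv Γ (imp (cneg (disj (l.map F))) Φ) := by
  induction h with
  | hyp h =>
    rcases h with h | ⟨i, hi, rfl⟩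
    · exact ⟨[], by simp, (hyp h).const_imp⟩
    · exact ⟨[i], by simpa using hi, imp_self⟩
  | thm h => exact ⟨[], by simp, (thm h).const_imp⟩
  | mp _ _ ih₁ ih₂ =>
    obtain ⟨l₁, hl₁, h₁⟩ := ih₁
    obtain ⟨l₂, hl₂, h₂⟩ := ih₂
    refine ⟨l₁ ++ l₂, fun i hi => (List.mem_append.1 hi).elim (hl₁ i) (hl₂ i), intro ?_⟩
    rw [List.map_append]
    refine Prv.mp (.mp (.intro ?_) h₁.weaken) (.mp (.intro ?_) h₂.weaken)
    · exact head.disj_append_left.mp head.weaken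
    · exact head.disj_append_right.mp head.weaken

end Prv

end LocalDerivability

end QBK

/-! ### Replacing constants by fresh variables -/

namespace QBK

/-- The signature `σ` with the set `K` of constant symbols in place of its own. -/
@[reducible] def Signature.withConst (σ : Signature.{u, v}) (K : Type w) : Signature.{u, w} where
  Pred := σ.Pred
  arity := σ.arity
  Const := K

section ReplaceConst

variable {σ : Signature.{u, v}} {K : Type w}

/-- Replacement of constants by terms over another set of constants. -/
def Term.replaceConst (θ : σ.Const → Term (σ.withConst K)) : Term σ → Term (σ.withConst K)
  | .var x => .var x
  | .const c => θ c

/-- All constants of the term belong to `S`. -/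
def Term.ConstsIn (S : Set σ.Const) (t : Term σ) : Prop := ∀ c, t = .const c → c ∈ S

namespace Formula

/-- Replacement of constants by terms over another set of constants. -/
def replaceConst (θ : σ.Const → Term (σ.withConst K)) : Formula σ → Formula (σ.withConst K)
  | atom P ts => atom (σ := σ.withConst K) P (fun i => (ts i).replaceConst θ)
  | bot => bot
  | imp Φ Ψ => imp (replaceConst θ Φ) (replaceConst θ Ψ)
  | and Φ Ψ => and (replaceConst θ Φ) (replaceConst θ Ψ)
  | or Φ Ψ => or (replaceConst θ Φ) (replaceConst θ Ψ)
  | neg Φ => neg (replaceConst θ Φ)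
  | box Φ => box (replaceConst θ Φ)
  | dia Φ => dia (replaceConst θ Φ)
  | all x Φ => all x (replaceConst θ Φ)
  | ex x Φ => ex x (replaceConst θ Φ)

/-- All constants of the formula belong to `S`. -/
def ConstsIn (S : Set σ.Const) : Formula σ → Prop
  | atom _ ts => ∀ i, (ts i).ConstsIn S
  | bot => True
  | imp Φ Ψ => ConstsIn S Φ ∧ ConstsIn S Ψ
  | and Φ Ψ => ConstsIn S Φ ∧ ConstsIn S Ψ
  | or Φ Ψ => ConstsIn S Φ ∧ ConstsIn S Ψ
  | neg Φ => ConstsIn S Φ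
  | box Φ => ConstsIn S Φ
  | dia Φ => ConstsIn S Φ
  | all _ Φ => ConstsIn S Φ
  | ex _ Φ => ConstsIn S Φ

/-- A number above all variables of the term. -/
def _root_.QBK.Term.varBound : Term σ → ℕ
  | .var x => x + 1
  | .const _ => 0

/-- A number above all free and bound variables of the formula. -/
def varBound : Formula σ → ℕ
  | atom _ ts => Finset.univ.sup fun i => (ts i).varBound
  | bot => 0
  | imp Φ Ψ => max (varBound Φ) (varBound Ψ)
  | and Φ Ψ => max (varBound Φ) (varBound Ψ)
  | or Φ Ψ => max (varBound Φ) (varBound Ψ)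
  | neg Φ => varBound Φ
  | box Φ => varBound Φ
  | dia Φ => varBound Φ
  | all x Φ => max (x + 1) (varBound Φ)
  | ex x Φ => max (x + 1) (varBound Φ)

theorem IsFree.lt_varBound {Φ : Formula σ} {x : Var} (h : IsFree x Φ) : x < Φ.varBound := by
  induction Φ with
  | atom P ts =>
    obtain ⟨i, hi⟩ := h
    have : (ts i).varBound ≤ _ := Finset.le_sup (f := fun i => (ts i).varBound) (Finset.mem_univ i)
    rw [hi] at this
    exact this
  | bot => exact h.elim
  | imp Φ Ψ ih₁ ih₂ | and Φ Ψ ih₁ ih₂ | or Φ Ψ ih₁ ih₂ =>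
    rcases h with h | h
    · exact lt_max_of_lt_left (ih₁ h)
    · exact lt_max_of_lt_right (ih₂ h)
  | neg Φ ih | box Φ ih | dia Φ ih => exact ih h
  | all y Φ ih | ex y Φ ih => exact lt_max_of_lt_right (ih h.2)

theorem ConstsIn.mono {S T : Set σ.Const} (h : S ⊆ T) {Φ : Formula σ} (hΦ : Φ.ConstsIn S) :
    Φ.ConstsIn T := by
  induction Φ with
  | atom P ts => exact fun i c hc => h (hΦ i c hc)
  | bot => trivial
  | imp Φ Ψ ih₁ ih₂ | and Φ Ψ ih₁ ih₂ | or Φ Ψ ih₁ ih₂ => exact ⟨ih₁ hΦ.1, ih₂ hΦ.2⟩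
  | neg Φ ih | box Φ ih | dia Φ ih | all x Φ ih | ex x Φ ih => exact ih hΦ

theorem ConstsIn.subst {S : Set σ.Const} {Φ : Formula σ} (hΦ : Φ.ConstsIn S)
    {s : Var → Term σ} (hs : ∀ x, (s x).ConstsIn S) : (Φ.subst s).ConstsIn S := by
  induction Φ generalizing s with
  | atom P ts =>
    intro i
    have := hΦ i
    cases ht : ts i with
    | var x => simpa [Term.subst, ht] using hs x
    | const c => simpa [Term.subst, ht] using this
  | bot => trivial
  | imp Φ Ψ ih₁ ih₂ | and Φ Ψ ih₁ ih₂ | or Φ Ψ ih₁ ih₂ => exact ⟨ih₁ hΦ.1 hs, ih₂ hΦ.2 hs⟩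
  | neg Φ ih | box Φ ih | dia Φ ih => exact ih hΦ hs
  | all x Φ ih | ex x Φ ih =>
    refine ih hΦ fun y => ?_
    by_cases hy : y = x
    · simp [hy, Term.ConstsIn]
    · simpa [hy] using hs y

theorem ConstsIn.subst1 {S : Set σ.Const} {Φ : Formula σ} (hΦ : Φ.ConstsIn S) (x : Var)
    {t : Term σ} (ht : t.ConstsIn S) : (Φ.subst1 x t).ConstsIn S := by
  refine hΦ.subst fun y => ?_
  by_cases hy : y = x
  · simpa [hy] using ht
  · simp [hy, Term.ConstsIn]

theorem constsIn_lift {A : Type w} {S : Set (σ.adjoin A).Const} (hS : ∀ c, Sum.inl c ∈ S)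
    (Φ : Formula σ) : (Φ.lift A).ConstsIn S := by
  induction Φ with
  | atom P ts =>
    intro i c hc
    cases ht : ts i with
    | var x => simp [Term.lift, ht] at hc
    | const d =>
      simp only [Term.lift, ht, Term.const.injEq] at hc
      exact hc ▸ hS d
  | bot => trivial
  | imp Φ Ψ ih₁ ih₂ | and Φ Ψ ih₁ ih₂ | or Φ Ψ ih₁ ih₂ => exact ⟨ih₁, ih₂⟩
  | neg Φ ih | box Φ ih | dia Φ ih | all x Φ ih | ex x Φ ih => exact ih

theorem replaceConst_eq_self {θ : σ.Const → Term σ} {S : Set σ.Const} {Φ : Formula σ}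
    (hΦ : Φ.ConstsIn S) (h : ∀ c ∈ S, θ c = .const c) :
    replaceConst (K := σ.Const) θ Φ = Φ := by
  induction Φ with
  | atom P ts =>
    simp only [replaceConst]
    congr 1
    funext i
    have := hΦ i
    cases ht : ts i with
    | var x => rfl
    | const c => exact h c (this c ht)
  | bot => rfl
  | imp Φ Ψ ih₁ ih₂ | and Φ Ψ ih₁ ih₂ | or Φ Ψ ih₁ ih₂ =>
    simp only [replaceConst, ih₁ hΦ.1, ih₂ hΦ.2]
  | neg Φ ih | box Φ ih | dia Φ ih | all x Φ ih | ex x Φ ih =>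
    simp only [replaceConst, ih hΦ]

theorem replaceConst_lift {A : Type w} {θ : (σ.adjoin A).Const → Term σ}
    (h : ∀ c, θ (Sum.inl c) = .const c) (Φ : Formula σ) :
    replaceConst (K := σ.Const) θ (Φ.lift A) = Φ := by
  induction Φ with
  | atom P ts =>
    simp only [lift, replaceConst]
    congr 1
    funext i
    cases ht : ts i with
    | var x => rfl
    | const c => exact h c
  | bot => rfl
  | imp Φ Ψ ih₁ ih₂ | and Φ Ψ ih₁ ih₂ | or Φ Ψ ih₁ ih₂ =>
    simp only [lift, replaceConst, ih₁, ih₂]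
  | neg Φ ih | box Φ ih | dia Φ ih | all x Φ ih | ex x Φ ih =>
    simp only [lift, replaceConst, ih]

variable {θ : σ.Const → Term (σ.withConst K)}

theorem isFree_replaceConst {x : Var} (hx : ∀ c, θ c ≠ .var x) {Φ : Formula σ} :
    IsFree x (Φ.replaceConst θ) ↔ IsFree x Φ := by
  induction Φ with
  | atom P ts =>
    simp only [replaceConst, IsFree]
    refine exists_congr fun i => ?_
    cases ts i <;> simp [Term.replaceConst, hx]
  | _ => simp_all [replaceConst, IsFree]

/-- A variable that replaces a constant becomes exposed to `s`, whereas the constant was not; hence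
`s` has to fix it. -/
theorem replaceConst_subst {s : Var → Term σ} (hs : ∀ c y, θ c = .var y → s y = .var y)
    (Φ : Formula σ) :
    (Φ.subst s).replaceConst θ =
      (Φ.replaceConst θ).subst fun x => (s x).replaceConst θ := by
  induction Φ generalizing s with
  | atom P ts =>
    simp only [subst, replaceConst]
    congr 1
    funext i
    cases ts i with
    | var x => rfl
    | const c =>
      simp only [Term.subst, Term.replaceConst]
      cases hc : θ c with
      | var y => simp [hs c y hc]
      | const d => rfl
  | bot => rfl
  | imp Φ Ψ ih₁ ih₂ | and Φ Ψ ih₁ ih₂ | or Φ Ψ ih₁ ih₂ =>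
    simp only [subst, replaceConst, ih₁ hs, ih₂ hs]
  | neg Φ ih | box Φ ih | dia Φ ih =>
    simp only [subst, replaceConst, ih hs]
  | all x Φ ih | ex x Φ ih =>
    simp only [subst, replaceConst]
    rw [ih]
    · congr 2
      funext y
      by_cases hy : y = x
      · simp [hy, Term.replaceConst]
      · simp [hy]
    · intro c y hc
      by_cases hy : y = x
      · simp [hy]
      · simpa [hy] using hs c y hc

theorem replaceConst_subst1 {x : Var} (hx : ∀ c, θ c ≠ .var x) (Φ : Formula σ) (t : Term σ) :
    (Φ.subst1 x t).replaceConst θ = (Φ.replaceConst θ).subst1 x (t.replaceConst θ) := by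
  rw [subst1, replaceConst_subst]
  · rw [subst1]
    congr 1
    funext y
    by_cases hy : y = x
    · simp [hy]
    · simp [hy, Term.replaceConst]
  · intro c y hc
    have : y ≠ x := fun h => hx c (h ▸ hc)
    simp [this]

/-- The new variables lie above all variables of `Φ`, so no quantifier of `Φ` captures them. -/
theorem FreeFor.replaceConst {t : Term σ} {x : Var} (hx : ∀ c, θ c ≠ .var x) {Φ : Formula σ}
    (h : FreeFor t x Φ) (hθ : ∀ c y, θ c = .var y → Φ.varBound ≤ y) :
    FreeFor (t.replaceConst θ) x (Φ.replaceConst θ) := by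
  induction Φ with
  | atom P ts => trivial
  | bot => trivial
  | imp Φ Ψ ih₁ ih₂ | and Φ Ψ ih₁ ih₂ | or Φ Ψ ih₁ ih₂ =>
    exact ⟨ih₁ h.1 fun c y hc => (le_max_left _ _).trans (hθ c y hc),
      ih₂ h.2 fun c y hc => (le_max_right _ _).trans (hθ c y hc)⟩
  | neg Φ ih | box Φ ih | dia Φ ih => exact ih h hθ
  | all y Φ ih | ex y Φ ih =>
    intro hf
    obtain ⟨hty, ht⟩ := h ⟨hf.1, (isFree_replaceConst hx).1 hf.2⟩
    refine ⟨fun hy => ?_, ih ht fun c y hc => (le_max_right _ _).trans (hθ c y hc)⟩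
    cases t with
    | var z => exact hty (by simpa [Term.replaceConst] using hy)
    | const c =>
      have := (le_max_left _ _).trans (hθ c y hy)
      omega

theorem not_isFree_var_of_le {Φ : Formula σ} {m : Var} (h : Φ.varBound ≤ m) : ¬ IsFree m Φ :=
  fun hf => h.not_gt hf.lt_varBound

theorem freeFor_subst1_var {Φ : Formula σ} {x m : Var} (hm : Φ.varBound ≤ m) :
    FreeFor (.var x) m (Φ.subst1 x (.var m)) := by
  -- A quantifier updates the substitution, so the induction needs a condition that survives
  -- updates.
  suffices H : ∀ s : Var → Term σ, (∀ y, s y = .var m → y = m ∨ y = x) →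
      FreeFor (.var x) m (Φ.subst s) by
    refine H _ fun y hy => ?_
    by_cases hyx : y = x
    · exact Or.inr hyx
    · exact Or.inl (by simpa [hyx] using hy)
  induction Φ with
  | atom P ts => exact fun _ _ => trivial
  | bot => exact fun _ _ => trivial
  | imp Φ Ψ ih₁ ih₂ | and Φ Ψ ih₁ ih₂ | or Φ Ψ ih₁ ih₂ =>
    exact fun s hs => ⟨ih₁ (le_of_max_le_left hm) s hs, ih₂ (le_of_max_le_right hm) s hs⟩
  | neg Φ ih | box Φ ih | dia Φ ih => exact fun s hs => ih hm s hs
  | all y Φ ih | ex y Φ ih =>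
    have hm' := le_of_max_le_right hm
    have hym : y < m := le_of_max_le_left hm
    intro s hs hf
    refine ⟨fun hxy => ?_, ih hm' _ fun z hz => ?_⟩
    -- Under a quantifier on `x` itself, `x` is not replaced, so `m` has no free occurrence there.
    · cases hxy
      obtain ⟨z, hz, hzm⟩ := exists_of_isFree_subst hf.2
      by_cases hzx : z = x
      · subst hzx
        simp only [Function.update_self, Term.var.injEq] at hzm
        exact hym.ne hzm
      · rcases hs z (by simpa [hzx] using hzm) with rfl | rfl
        · exact not_isFree_var_of_le hm' hz
        · exact hzx rfl
    · by_cases hzy : z = y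
      · subst hzy
        simp only [Function.update_self, Term.var.injEq] at hz
        exact absurd hz hym.ne
      · exact hs z (by simpa [hzy] using hz)

theorem subst1_var_subst1 {Φ : Formula σ} {x m : Var} (hm : Φ.varBound ≤ m) :
    (Φ.subst1 x (.var m)).subst1 m (.var x) = Φ := by
  suffices H : ∀ s s' : Var → Term σ, (∀ y < m, (s y).subst s' = .var y) →
      (∀ y < m, s' y = .var y) →
      (Φ.subst s).subst s' = Φ by
    refine H _ _ (fun y hy => ?_) fun y hy => by simp [hy.ne]
    by_cases hyx : y = x
    · simp [hyx, Term.subst]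
    · simp [hyx, Term.subst, hy.ne]
  induction Φ with
  | atom P ts =>
    intro s s' hs hs'
    simp only [subst]
    congr 1
    funext i
    cases ht : ts i with
    | const c => rfl
    | var y =>
      have hy : IsFree y (atom P ts) := ⟨i, ht⟩
      exact hs y (hy.lt_varBound.trans_le hm)
  | bot => exact fun _ _ _ _ => rfl
  | imp Φ Ψ ih₁ ih₂ | and Φ Ψ ih₁ ih₂ | or Φ Ψ ih₁ ih₂ =>
    intro s s' hs hs'
    simp only [subst, ih₁ (le_of_max_le_left hm) s s' hs hs',
      ih₂ (le_of_max_le_right hm) s s' hs hs']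
  | neg Φ ih | box Φ ih | dia Φ ih =>
    intro s s' hs hs'
    simp only [subst, ih hm s s' hs hs']
  | all z Φ ih | ex z Φ ih =>
    intro s s' hs hs'
    have hz := hs' z (le_of_max_le_left hm)
    simp only [subst]
    rw [Function.update_eq_self_iff.2 hz.symm, ih (le_of_max_le_right hm) _ s' (fun y hy => ?_) hs']
    by_cases hyz : y = z
    · simp [hyz, Term.subst, hz]
    · simpa [hyz] using hs y hy

end Formula

open Formula

/-- Only the instantiation axioms constrain the new variables: these must exceed the quantified
variable and all variables of its scope. -/
theorem AxiomScheme.replaceConst {Φ : Formula σ} (h : AxiomScheme Φ) :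
    ∃ N, ∀ θ : σ.Const → Term (σ.withConst K), (∀ c y, θ c = .var y → N ≤ y) →
      AxiomScheme (Φ.replaceConst θ) := by
  cases h with
  | q1 x t Φ h =>
    refine ⟨max (x + 1) Φ.varBound, fun θ hθ => ?_⟩
    have hx : ∀ c, θ c ≠ .var x := fun c hc =>
      not_lt.2 (le_of_max_le_left (hθ c x hc)) x.lt_succ_self
    simp only [Formula.replaceConst, replaceConst_subst1 hx]
    exact .q1 x _ _ (h.replaceConst hx fun c y hc => le_of_max_le_right (hθ c y hc))
  | q2 x t Φ h =>
    refine ⟨max (x + 1) Φ.varBound, fun θ hθ => ?_⟩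
    have hx : ∀ c, θ c ≠ .var x := fun c hc =>
      not_lt.2 (le_of_max_le_left (hθ c x hc)) x.lt_succ_self
    simp only [Formula.replaceConst, replaceConst_subst1 hx]
    exact .q2 x _ _ (h.replaceConst hx fun c y hc => le_of_max_le_right (hθ c y hc))
  | _ => exact ⟨0, fun θ _ => by constructor⟩

/-- Theorems remain theorems when constants are replaced by constants and sufficiently new
variables. -/
theorem Logic.replaceConst {Φ : Formula σ} (h : Logic Φ) :
    ∃ N, ∀ θ : σ.Const → Term (σ.withConst K), (∀ c y, θ c = .var y → N ≤ y) →
      Logic (Φ.replaceConst θ) := by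
  induction h with
  | ax h =>
    obtain ⟨N, hN⟩ := h.replaceConst (K := K)
    exact ⟨N, fun θ hθ => .ax (hN θ hθ)⟩
  | mp _ _ ih₁ ih₂ =>
    obtain ⟨N₁, h₁⟩ := ih₁
    obtain ⟨N₂, h₂⟩ := ih₂
    exact ⟨max N₁ N₂, fun θ hθ => .mp (h₁ θ fun c y hc => le_of_max_le_left (hθ c y hc))
      (h₂ θ fun c y hc => le_of_max_le_right (hθ c y hc))⟩
  | mb _ ih =>
    obtain ⟨N, hN⟩ := ih
    exact ⟨N, fun θ hθ => .mb (hN θ hθ)⟩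
  | md _ ih =>
    obtain ⟨N, hN⟩ := ih
    exact ⟨N, fun θ hθ => .md (hN θ hθ)⟩
  | @br1 Φ Ψ x hx _ ih =>
    obtain ⟨N, hN⟩ := ih
    refine ⟨max (x + 1) N, fun θ hθ => .br1 (fun hf => hx ((isFree_replaceConst ?_).1 hf))
      (hN θ fun c y hc => le_of_max_le_right (hθ c y hc))⟩
    exact fun c hc => not_lt.2 (le_of_max_le_left (hθ c x hc)) x.lt_succ_self
  | @br2 Φ Ψ x hx _ ih =>
    obtain ⟨N, hN⟩ := ih
    refine ⟨max (x + 1) N, fun θ hθ => .br2 (fun hf => hx ((isFree_replaceConst ?_).1 hf))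
      (hN θ fun c y hc => le_of_max_le_right (hθ c y hc))⟩
    exact fun c hc => not_lt.2 (le_of_max_le_left (hθ c x hc)) x.lt_succ_self

theorem Prv.replaceConst {Γ : Set (Formula σ)} {Φ : Formula σ} (h : Prv Γ Φ) :
    ∃ N, ∀ θ : σ.Const → Term (σ.withConst K), (∀ c y, θ c = .var y → N ≤ y) →
      Prv (Formula.replaceConst θ '' Γ) (Φ.replaceConst θ) := by
  induction h with
  | hyp h => exact ⟨0, fun θ _ => .hyp ⟨_, h, rfl⟩⟩
  | thm h =>
    obtain ⟨N, hN⟩ := h.replaceConst (K := K)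
    exact ⟨N, fun θ hθ => .thm (hN θ hθ)⟩
  | mp _ _ ih₁ ih₂ =>
    obtain ⟨N₁, h₁⟩ := ih₁
    obtain ⟨N₂, h₂⟩ := ih₂
    exact ⟨max N₁ N₂, fun θ hθ => .mp (h₁ θ fun c y hc => le_of_max_le_left (hθ c y hc))
      (h₂ θ fun c y hc => le_of_max_le_right (hθ c y hc))⟩

/-- Generalization on constants. -/
theorem Prv.of_subst1_const {Γ : Set (Formula σ)} (hΓ : ∀ Φ ∈ Γ, Φ.IsSentence) {c : σ.Const}
    (hc : ∀ Φ ∈ Γ, Φ.ConstsIn {c}ᶜ) {Φ : Formula σ} (hΦ : Φ.ConstsIn {c}ᶜ) {x : Var}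
    (h : Prv Γ (Φ.subst1 x (.const c))) : Prv Γ Φ := by
  classical
  obtain ⟨N, hN⟩ := h.replaceConst (K := σ.Const)
  -- Beyond `N` the derivation survives the replacement of `c` by `m`; beyond `x` and the variables
  -- of `Φ`, the exchange of `x` for `m` can be undone without capture.
  let m := max N (max (x + 1) Φ.varBound)
  have hmΦ : Φ.varBound ≤ m := (le_max_right _ _).trans (le_max_right _ _)
  have hmx : x < m := Nat.lt_of_succ_le ((le_max_left _ _).trans (le_max_right _ _))
  let θ : σ.Const → Term σ := Function.update Term.const c (.var m)
  have hθ : ∀ d y, θ d = .var y → y = m := by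
    intro d y hd
    by_cases hdc : d = c
    · simpa [θ, hdc, eq_comm] using hd
    · simp [θ, hdc] at hd
  have hself : ∀ Ψ : Formula σ, Ψ.ConstsIn {c}ᶜ →
      Formula.replaceConst (K := σ.Const) θ Ψ = Ψ := fun Ψ hΨ =>
    replaceConst_eq_self hΨ fun d hd => by simp [θ, show d ≠ c from hd]
  have h₁ := hN θ fun d y hd => (hθ d y hd) ▸ le_max_left _ _
  rw [replaceConst_subst1 fun d hd => hmx.ne (hθ d x hd), hself Φ hΦ] at h₁
  have h₂ : Prv Γ (Φ.subst1 x (.var m)) := by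
    simp only [Term.replaceConst] at h₁
    rw [show θ c = .var m from Function.update_self ..] at h₁
    refine h₁.mono ?_
    rintro _ ⟨Ψ, hΨ, rfl⟩
    exact (hself Ψ (hc Ψ hΨ)).symm ▸ hΨ
  -- Generalizing over `m` and instantiating with `x` gives back `Φ`.
  have h₃ := (h₂.gen hΓ m).instantiate (freeFor_subst1_var hmΦ)
  rwa [subst1_var_subst1 hmΦ] at h₃

end ReplaceConst
end QBK

/-! ### Coding of formulas by trees -/

namespace QBK

/-- Finite trees that code formulas. -/
inductive Code (σ : Signature.{u, v}) : Type (max u v w)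
  | pred (P : σ.Pred)
  | const (c : σ.Const)
  | nat (n : ULift.{w} ℕ)
  | node (a b : Code σ)
  | branch (n : ℕ) (f : Fin n → Code σ)

/-- The number of nodes of a tree. -/
def Code.size {σ : Signature.{u, v}} : Code.{u, v, w} σ → ℕ
  | .pred _ => 1
  | .const _ => 1
  | .nat _ => 1
  | .node a b => a.size + b.size + 1
  | .branch _ f => (∑ i, (f i).size) + 1

/-- The signature `σ` enlarged by parameters, which are pairs of a level and a tree. -/
@[reducible] def Signature.ext (σ : Signature.{u, v}) : Signature.{u, max u v w} :=
  σ.adjoin (ℕ × Code.{u, v, w} σ)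

section Henkin

variable {σ : Signature.{u, v}}

/-- A numeral as a tree. -/
def Code.num (n : ℕ) : Code.{u, v, w} σ := .nat ⟨n⟩

theorem Code.num_inj {m n : ℕ} : (num m : Code.{u, v, w} σ) = num n ↔ m = n := by simp [num]

theorem Code.num_ne_node {n : ℕ} {a b : Code.{u, v, w} σ} : num n ≠ node a b := by simp [num]

open Code in
/-- The code of a term. -/
def Term.code : Term (Signature.ext.{u, v, w} σ) → Code.{u, v, w} σ
  | .var x => node (num 0) (num x)
  | .const (.inl c) => node (num 1) (.const c)
  | .const (.inr (i, t)) => node (num 2) (node (num i) t)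

namespace Formula

open Code in
/-- The code of a formula. -/
def code : Formula (Signature.ext.{u, v, w} σ) → Code.{u, v, w} σ
  | atom P ts => node (num 0) (node (pred P) (branch (σ.arity P) fun i => (ts i).code))
  | bot => num 0
  | imp Φ Ψ => node (num 1) (node (code Φ) (code Ψ))
  | and Φ Ψ => node (num 2) (node (code Φ) (code Ψ))
  | or Φ Ψ => node (num 3) (node (code Φ) (code Ψ))
  | neg Φ => node (num 4) (code Φ)
  | box Φ => node (num 5) (code Φ)
  | dia Φ => node (num 6) (code Φ)
  | all x Φ => node (num 7) (node (num x) (code Φ))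
  | ex x Φ => node (num 8) (node (num x) (code Φ))

theorem _root_.QBK.Term.code_injective :
    Function.Injective (Term.code : Term (Signature.ext.{u, v, w} σ) → Code.{u, v, w} σ) := by
  rintro (x | c | ⟨i, t⟩) (y | d | ⟨j, t'⟩) h <;> simp_all [Term.code, Code.num_inj]

/-- Ensures that distinct existential formulas have distinct witnesses at a given level. -/
theorem code_injective :
    Function.Injective (code : Formula (Signature.ext.{u, v, w} σ) → Code.{u, v, w} σ) := by
  intro Φ
  induction Φ with
  | atom P ts =>
    intro Ψ h
    cases Ψ with
    | atom Q ts' =>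
      simp only [code, Code.node.injEq, Code.pred.injEq, true_and] at h
      obtain ⟨rfl, h⟩ := h
      simp only [Code.branch.injEq, heq_eq_eq, true_and] at h
      congr 1
      funext i
      exact Term.code_injective (congrFun h i)
    | _ => simp [code, Code.num_inj, Code.num_ne_node.symm] at h
  | bot => intro Ψ h; cases Ψ <;> simp_all [code, Code.num_ne_node]
  | imp Φ₁ Φ₂ ih₁ ih₂ | and Φ₁ Φ₂ ih₁ ih₂ | or Φ₁ Φ₂ ih₁ ih₂ =>
    intro Ψ h
    cases Ψ <;> simp [code, Code.num_inj, Code.num_ne_node.symm] at h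
    rw [ih₁ h.1, ih₂ h.2]
  | neg Φ ih | box Φ ih | dia Φ ih =>
    intro Ψ h
    cases Ψ <;> simp [code, Code.num_inj, Code.num_ne_node.symm] at h
    rw [ih h]
  | all x Φ ih | ex x Φ ih =>
    intro Ψ h
    cases Ψ <;> simp [code, Code.num_inj, Code.num_ne_node.symm] at h
    rw [h.1, ih h.2]

/-- The parameters in a formula are smaller than its code. -/
theorem constsIn_size_lt (Φ : Formula (Signature.ext.{u, v, w} σ)) :
    Φ.ConstsIn {c | ∀ i t, c = Sum.inr (i, t) → t.size < Φ.code.size} := by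
  induction Φ with
  | atom P ts =>
    rintro j c hc i t rfl
    have h₁ : (ts j).code.size ≤ ∑ i, (ts i).code.size :=
      Finset.single_le_sum (f := fun i => (ts i).code.size) (fun _ _ => Nat.zero_le _)
        (Finset.mem_univ j)
    have h₂ : t.size < (ts j).code.size := by
      rw [hc]
      simp only [Term.code, Code.size]
      omega
    have h₃ : (atom P ts).code.size = 1 + (1 + (∑ i, (ts i).code.size + 1) + 1) + 1 := rfl
    omega
  | bot => trivial
  | imp Φ Ψ ih₁ ih₂ | and Φ Ψ ih₁ ih₂ | or Φ Ψ ih₁ ih₂ =>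
    refine ⟨ih₁.mono fun c hc i t hct => ?_, ih₂.mono fun c hc i t hct => ?_⟩ <;>
    · have := hc i t hct
      simp only [code, Code.size]
      omega
  | neg Φ ih | box Φ ih | dia Φ ih | all x Φ ih | ex x Φ ih =>
    refine ih.mono fun c hc i t hct => ?_
    have := hc i t hct
    simp only [code, Code.size]
    omega

end Formula

/-! ### Henkin axioms and complete theories -/

open Formula

/-- The constants of `σ` and the parameters of level less than `n`. -/
def constsBelow (σ : Signature.{u, v}) (n : ℕ) : Set (Signature.ext.{u, v, w} σ).Const :=
  {c | ∀ i t, c = Sum.inr (i, t) → i < n}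

theorem constsBelow_mono {m n : ℕ} (h : m ≤ n) :
    constsBelow.{u, v, w} σ m ⊆ constsBelow σ n :=
  fun _ hc i t hct => (hc i t hct).trans_le h

/-- The sentences with parameters of level less than `n`. -/
def sentencesBelow (σ : Signature.{u, v}) (n : ℕ) :
    Set (Formula (Signature.ext.{u, v, w} σ)) :=
  {Φ | Φ.IsSentence ∧ Φ.ConstsIn (constsBelow σ n)}

theorem sentencesBelow_mono {m n : ℕ} (h : m ≤ n) :
    sentencesBelow.{u, v, w} σ m ⊆ sentencesBelow σ n :=
  fun _ hΦ => ⟨hΦ.1, hΦ.2.mono (constsBelow_mono h)⟩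

/-- The parameter of level `n` that witnesses `∃ x Φ`. -/
def witness (n : ℕ) (x : Var) (Φ : Formula (Signature.ext.{u, v, w} σ)) :
    (Signature.ext.{u, v, w} σ).Const :=
  Sum.inr (n, (ex x Φ).code)

theorem witness_mem (n : ℕ) (x : Var) (Φ : Formula (Signature.ext.{u, v, w} σ)) :
    witness n x Φ ∈ constsBelow σ (n + 1) := by
  intro i t h
  cases h
  exact n.lt_succ_self

/-- The Henkin axiom for `∃ x Φ`. -/
def henkinAxiom (n : ℕ) (p : Var × Formula (Signature.ext.{u, v, w} σ)) :
    Formula (Signature.ext.{u, v, w} σ) :=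
  imp (ex p.1 p.2) (p.2.subst1 p.1 (.const (witness n p.1 p.2)))

theorem subst1_mem_sentencesBelow {n : ℕ} {x : Var} {Φ : Formula (Signature.ext.{u, v, w} σ)}
    (h : ex x Φ ∈ sentencesBelow σ n) {c : (Signature.ext.{u, v, w} σ).Const}
    (hc : c ∈ constsBelow σ n) : Φ.subst1 x (.const c) ∈ sentencesBelow σ n := by
  refine ⟨fun y hy => ?_, ConstsIn.subst1 (Φ := Φ) h.2 x fun d hd => Term.const.inj hd ▸ hc⟩
  obtain ⟨z, hz, hzy⟩ := exists_of_isFree_subst hy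
  by_cases hzx : z = x
  · simp [hzx] at hzy
  · exact h.1 z ⟨hzx, hz⟩

theorem henkinAxiom_mem {n : ℕ} {p : Var × Formula (Signature.ext.{u, v, w} σ)}
    (h : ex p.1 p.2 ∈ sentencesBelow σ (n + 1)) :
    henkinAxiom n p ∈ sentencesBelow σ (n + 1) := by
  have := subst1_mem_sentencesBelow h (witness_mem n p.1 p.2)
  exact ⟨fun x hx => hx.elim (h.1 x) (this.1 x), h.2, this.2⟩

/-- The existential sentences may already contain parameters of level `n`, so one level serves all
of them, with no iteration. Freshness comes from size: a parameter is smaller than the code of any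
formula containing it, so the witness of the largest formula occurs in no formula whose code is at
most as large. -/
theorem consistent_henkinAxioms {n : ℕ} {T : Set (Formula (Signature.ext.{u, v, w} σ))}
    (hT : T ⊆ sentencesBelow σ n) (hc : ¬ Prv T bot) :
    ¬ Prv (T ∪ henkinAxiom n '' {p | ex p.1 p.2 ∈ sentencesBelow σ (n + 1)}) bot := by
  classical
  intro h
  obtain ⟨s, hs, h⟩ := h.exists_finset
  revert hs h
  -- The axiom with the largest code is removed first.
  induction s using Finset.induction_on_max_value
    (fun p : Var × Formula (Signature.ext.{u, v, w} σ) => (ex p.1 p.2).code.size) with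
  | empty => simpa using fun h => hc h
  | insert a s has hmax ih =>
    intro hs h
    obtain ⟨x, Φ⟩ := a
    rw [Finset.coe_insert, Set.insert_subset_iff] at hs
    refine ih hs.2 ?_
    rw [Finset.coe_insert, Set.image_insert_eq, Set.union_insert] at h
    have hsent : ∀ Ψ ∈ T ∪ henkinAxiom n '' ↑s, Ψ.IsSentence := by
      rintro Ψ (hΨ | ⟨p, hp, rfl⟩)
      · exact (hT hΨ).1
      · exact (henkinAxiom_mem (hs.2 hp)).1
    have hsmall : ∀ Ψ : Formula (Signature.ext.{u, v, w} σ),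
        Ψ.code.size ≤ (ex x Φ).code.size → Ψ.ConstsIn {witness n x Φ}ᶜ := by
      intro Ψ hΨ
      refine (constsIn_size_lt Ψ).mono fun c hc => ?_
      rintro rfl
      exact absurd (hc _ _ rfl) (not_lt.2 hΨ)
    have hfresh : ∀ Ψ ∈ T ∪ henkinAxiom n '' ↑s, Ψ.ConstsIn {witness n x Φ}ᶜ := by
      rintro Ψ (hΨ | ⟨⟨y, Θ⟩, hp, rfl⟩)
      · refine (hT hΨ).2.mono fun c hc => ?_
        rintro rfl
        exact lt_irrefl _ (hc _ _ rfl)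
      · have hΘ : (ex y Θ).ConstsIn {witness n x Φ}ᶜ := hsmall _ (hmax _ hp)
        refine ⟨hΘ, ConstsIn.subst1 (Φ := Θ) hΘ y fun d hd => ?_⟩
        rw [← Term.const.inj hd]
        intro h
        simp only [witness, Set.mem_singleton_iff, Sum.inr.injEq, Prod.mk.injEq, true_and] at h
        -- Equal witnesses would come from equal formulas, but the removed pair is not in `s`.
        have := code_injective h
        simp only [ex.injEq] at this
        obtain ⟨rfl, rfl⟩ := this
        exact has hp
    have h₁ : Prv (T ∪ henkinAxiom n '' ↑s) (cneg (henkinAxiom n (x, Φ))) := h.intro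
    -- A refuted Henkin axiom yields `∃ x Φ` together with the negation of its witness instance. The
    -- witness is fresh, so that negation generalizes to `∀ x ¬Φ`.
    have hex : Prv (T ∪ henkinAxiom n '' ↑s) (ex x Φ) :=
      .by_contra (.mp (.intro (.exfalso (.mp .head Prv.head.weaken))) h₁.weaken)
    have h₂ : Prv (T ∪ henkinAxiom n '' ↑s)
        ((cneg Φ).subst1 x (.const (witness n x Φ))) :=
      .intro (.mp Prv.head.const_imp h₁.weaken)
    have hΦ : (cneg Φ).ConstsIn {witness n x Φ}ᶜ :=
      ⟨hsmall Φ (by simp only [code, Code.size]; omega), trivial⟩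
    exact hex.mp ((h₂.of_subst1_const hsent hfresh hΦ).gen hsent x).not_ex_of_all_not

/-- Complete consistent Henkin theories in the language of level `n`. -/
structure IsTheory (n : ℕ) (T : Set (Formula (Signature.ext.{u, v, w} σ))) : Prop where
  subset : T ⊆ sentencesBelow σ n
  consistent : ¬ Prv T bot
  complete : ∀ Φ ∈ sentencesBelow σ n, Φ ∈ T ∨ cneg Φ ∈ T
  henkin : ∀ x Φ, ex x Φ ∈ T → ∃ c ∈ constsBelow σ n, Φ.subst1 x (.const c) ∈ T

theorem cneg_mem_sentencesBelow {n : ℕ} {Φ : Formula (Signature.ext.{u, v, w} σ)}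
    (h : Φ ∈ sentencesBelow σ n) : cneg Φ ∈ sentencesBelow σ n :=
  ⟨fun x hx => hx.elim (h.1 x) id, h.2, trivial⟩

/-- Zorn's lemma is applied above `T` and the Henkin axioms: maximality gives completeness, and the
axioms supply the witnesses. The cost is a single level. -/
theorem exists_isTheory {n : ℕ} {T : Set (Formula (Signature.ext.{u, v, w} σ))}
    (hT : T ⊆ sentencesBelow σ n) (hc : ¬ Prv T bot) :
    ∃ T', T ⊆ T' ∧ IsTheory (n + 1) T' := by
  obtain ⟨T', hTT', hmax⟩ := zorn_subset_nonempty
    {S | S ⊆ sentencesBelow.{u, v, w} σ (n + 1) ∧ ¬ Prv S bot} (by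
      intro C hC hchain hne
      refine ⟨⋃₀ C, ⟨Set.sUnion_subset fun S hS => (hC hS).1, fun h => ?_⟩,
        fun S hS => Set.subset_sUnion_of_mem hS⟩
      obtain ⟨S, hS, h⟩ := h.exists_mem_of_directedOn hchain.directedOn hne
      exact (hC hS).2 h)
    (T ∪ henkinAxiom n '' {p | ex p.1 p.2 ∈ sentencesBelow σ (n + 1)})
    ⟨Set.union_subset (hT.trans (sentencesBelow_mono n.le_succ))
      (Set.image_subset_iff.2 fun p hp => henkinAxiom_mem hp), consistent_henkinAxioms hT hc⟩
  have hsub := hmax.prop.1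
  have hcons := hmax.prop.2
  have hins : ∀ Φ ∈ sentencesBelow σ (n + 1), Φ ∉ T' → Prv T' (cneg Φ) := by
    intro Φ hΦ hΦT
    refine Prv.intro ?_
    by_contra h
    exact hΦT (hmax.le_of_ge (y := insert Φ T') ⟨Set.insert_subset hΦ hsub, h⟩
      (Set.subset_insert _ _) (Set.mem_insert _ _))
  have hcomp : ∀ Φ ∈ sentencesBelow σ (n + 1), Φ ∈ T' ∨ cneg Φ ∈ T' := by
    intro Φ hΦ
    by_contra! h
    exact hcons ((hins Φ hΦ h.1).mp (hins _ (cneg_mem_sentencesBelow hΦ) h.2))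
  refine ⟨T', Set.subset_union_left.trans hTT', hsub, hcons, hcomp, fun x Φ hΦ => ?_⟩
  have hmem := subst1_mem_sentencesBelow (hsub hΦ) (witness_mem n x Φ)
  refine ⟨_, witness_mem n x Φ, (hcomp _ hmem).resolve_right fun h => hcons ?_⟩
  exact ((Prv.hyp hΦ).mp (.hyp (hTT' (Or.inr ⟨(x, Φ), hsub hΦ, rfl⟩)))).mp (.hyp h)

namespace IsTheory

variable {n : ℕ} {T : Set (Formula (Signature.ext.{u, v, w} σ))}
  {Φ Ψ : Formula (Signature.ext.{u, v, w} σ)}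

theorem prv_iff_mem (hT : IsTheory n T) (hΦ : Φ ∈ sentencesBelow σ n) : Prv T Φ ↔ Φ ∈ T :=
  ⟨fun h => (hT.complete Φ hΦ).resolve_right fun h' => hT.consistent (h.mp (.hyp h')), .hyp⟩

theorem prv_cneg_iff (hT : IsTheory n T) (hΦ : Φ ∈ sentencesBelow σ n) :
    Prv T (cneg Φ) ↔ ¬ Prv T Φ :=
  ⟨fun h h' => hT.consistent (h'.mp h),
    fun h => .hyp ((hT.complete Φ hΦ).resolve_left fun h' => h (.hyp h'))⟩

end IsTheory

end Henkin

end QBK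

/-! ### The canonical model and the truth lemma -/

namespace QBK

section Canonical

variable {σ : Signature.{u, v}}

open Formula

namespace IsTheory

variable {n : ℕ} {T : Set (Formula (Signature.ext.{u, v, w} σ))}
  {Φ Ψ : Formula (Signature.ext.{u, v, w} σ)}

theorem prv_imp_iff (hT : IsTheory n T) (hΦ : Φ ∈ sentencesBelow σ n) :
    Prv T (imp Φ Ψ) ↔ ¬ Prv T Φ ∨ Prv T Ψ := by
  constructor
  · exact fun h => or_iff_not_imp_left.2 fun h' => (not_not.1 h').mp h
  · rintro (h | h)
    · exact .intro (.exfalso (Prv.head.mp ((hT.prv_cneg_iff hΦ).2 h).weaken))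
    · exact h.const_imp

theorem prv_and_iff : Prv T (and Φ Ψ) ↔ Prv T Φ ∧ Prv T Ψ :=
  ⟨fun h => ⟨h.left, h.right⟩, fun h => h.1.and_intro h.2⟩

theorem prv_or_iff (hT : IsTheory n T) (hΦ : Φ ∈ sentencesBelow σ n) :
    Prv T (or Φ Ψ) ↔ Prv T Φ ∨ Prv T Ψ := by
  constructor
  · intro h
    refine or_iff_not_imp_left.2 fun h' => h.cases (.intro (.exfalso ?_)) .imp_self
    exact Prv.head.mp ((hT.prv_cneg_iff hΦ).2 h').weaken
  · rintro (h | h)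
    exacts [h.inl, h.inr]

theorem prv_ex_iff (hT : IsTheory n T) {x : Var} (h : ex x Φ ∈ sentencesBelow σ n) :
    Prv T (ex x Φ) ↔ ∃ c ∈ constsBelow σ n, Prv T (Φ.subst1 x (.const c)) := by
  constructor
  · intro hp
    obtain ⟨c, hc, hm⟩ := hT.henkin x Φ ((hT.prv_iff_mem h).1 hp)
    exact ⟨c, hc, .hyp hm⟩
  · rintro ⟨c, -, hp⟩
    exact hp.mp (.ax (.q2 x _ Φ (freeFor_const Φ x c)))

/-- If `∀ x Φ` is not provable, then `∃ x ¬Φ` is, and its Henkin witness contradicts the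
corresponding instance. -/
theorem prv_all_iff (hT : IsTheory n T) {x : Var} (h : all x Φ ∈ sentencesBelow σ n) :
    Prv T (all x Φ) ↔ ∀ c ∈ constsBelow σ n, Prv T (Φ.subst1 x (.const c)) := by
  refine ⟨fun hp c _ => hp.instantiate (freeFor_const Φ x c), fun hall => ?_⟩
  by_contra hp
  have hex : ex x (cneg Φ) ∈ sentencesBelow σ n :=
    ⟨fun y hy => h.1 y ⟨hy.1, hy.2.resolve_right id⟩, h.2, trivial⟩
  have : ¬ Prv T (cneg (ex x (cneg Φ))) := fun h' => hp h'.all_of_not_ex_not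
  rw [hT.prv_cneg_iff hex, not_not, hT.prv_ex_iff hex] at this
  obtain ⟨c, hc, h'⟩ := this
  exact hT.consistent ((hall c hc).mp h')

end IsTheory

theorem Prv.iff {τ : Signature.{u, v}} {Γ : Set (Formula τ)} {Φ Ψ : Formula τ}
    (h : Prv Γ (iff Φ Ψ)) : Prv Γ Φ ↔ Prv Γ Ψ :=
  ⟨fun h' => h'.mp h.left, fun h' => h'.mp h.right⟩

variable (σ) in
/-- The worlds of the canonical model. -/
def CanonicalWorld : Type (max u v w) :=
  {p : ℕ × Set (Formula (Signature.ext.{u, v, w} σ)) // IsTheory (p.1 + 1) p.2}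

namespace CanonicalWorld

/-- The level of a world. -/
def level (a : CanonicalWorld.{u, v, w} σ) : ℕ := a.1.1 + 1

/-- The theory of a world. -/
def theory (a : CanonicalWorld.{u, v, w} σ) : Set (Formula (Signature.ext.{u, v, w} σ)) := a.1.2

theorem isTheory (a : CanonicalWorld.{u, v, w} σ) : IsTheory a.level a.theory := a.2

/-- The canonical accessibility relation raises the level by one. -/
def R (a b : CanonicalWorld.{u, v, w} σ) : Prop :=
  b.level = a.level + 1 ∧ ∀ Φ, box Φ ∈ a.theory → Φ ∈ b.theory

variable {a : CanonicalWorld.{u, v, w} σ} {Φ : Formula (Signature.ext.{u, v, w} σ)}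

/-- If `□Φ` is not provable, then `¬Φ` is consistent with all `Ψ` such that `□Ψ` is in the theory,
by necessitation and distribution of `□`. This set lives at the level of `a`, so it extends to a
theory one level higher, which is a successor. -/
theorem prv_box_iff (hΦ : Φ ∈ sentencesBelow σ a.level) :
    Prv a.theory (box Φ) ↔ ∀ b, R a b → Prv b.theory Φ := by
  constructor
  · exact fun h b hb => .hyp (hb.2 Φ ((a.isTheory.prv_iff_mem (Φ := box Φ) hΦ).1 h))
  · intro h
    by_contra hp
    obtain ⟨T, hT, hT'⟩ := exists_isTheory (n := a.level)
      (T := insert (cneg Φ) {Ψ | box Ψ ∈ a.theory})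
      (Set.insert_subset (cneg_mem_sentencesBelow hΦ) fun Ψ hΨ => a.isTheory.subset (a := box Ψ) hΨ)
      (fun h' => hp (h'.by_contra.box.mono (by rintro _ ⟨Ψ, hΨ, rfl⟩; exact hΨ)))
    exact hT'.consistent ((h ⟨(a.level, T), hT'⟩
      ⟨rfl, fun Ψ hΨ => hT (Or.inr hΨ)⟩).mp (.hyp (hT (Or.inl rfl))))

theorem prv_dia_iff (hΦ : Φ ∈ sentencesBelow σ a.level) :
    Prv a.theory (dia Φ) ↔ ∃ b, R a b ∧ Prv b.theory Φ := by
  have h := (Prv.ax (Γ := a.theory) (.m2 Φ)).iff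
  rw [a.isTheory.prv_cneg_iff (Φ := dia Φ) hΦ, prv_box_iff (cneg_mem_sentencesBelow hΦ)] at h
  rw [← not_iff_not, h, not_exists]
  refine forall_congr' fun b => ?_
  rw [not_and]
  refine forall_congr' fun hb => b.isTheory.prv_cneg_iff (sentencesBelow_mono ?_ hΦ)
  rw [hb.1]
  exact a.level.le_succ

end CanonicalWorld

/-- The sentence obtained by valuating the free variables by constants. -/
def Formula.ground (e : Var → (Signature.ext.{u, v, w} σ).Const) (Φ : Formula σ) :
    Formula (Signature.ext.{u, v, w} σ) :=
  (Φ.lift _).subst fun x => .const (e x)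

/-- The formula that is provable when `Φ` is verified, or falsified. -/
def Formula.signed {τ : Signature.{u, v}} : Polarity → Formula τ → Formula τ
  | .ver, Φ => Φ
  | .fal, Φ => neg Φ

/-- The interpretation of the constants of `σ` by themselves. -/
def constInl (c : σ.Const) : (Signature.ext.{u, v, w} σ).Const := Sum.inl c

theorem constInl_mem (c : σ.Const) (n : ℕ) : constInl.{u, v, w} c ∈ constsBelow σ n :=
  fun _ _ h => by cases h

theorem ground_mem_sentencesBelow {n : ℕ} {e : Var → (Signature.ext.{u, v, w} σ).Const}
    (he : ∀ x, e x ∈ constsBelow σ n) (Φ : Formula σ) : Φ.ground e ∈ sentencesBelow σ n :=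
  ⟨isSentence_subst_const _, (constsIn_lift (fun c => constInl_mem c n) Φ).subst
    fun x _ hc => Term.const.inj hc ▸ he x⟩

theorem ground_subst1 (e : Var → (Signature.ext.{u, v, w} σ).Const) (Φ : Formula σ) (x : Var)
    (c : (Signature.ext.{u, v, w} σ).Const) :
    ((Φ.lift _).subst (Function.update (fun y => .const (e y)) x (.var x))).subst1 x (.const c) =
      Φ.ground (Function.update e x c) := by
  rw [subst_update_subst1 fun y => ⟨e y, rfl⟩, ground]
  congr 1
  funext y
  by_cases hy : y = x <;> simp [hy]

theorem ground_atom (e : Var → (Signature.ext.{u, v, w} σ).Const) (P : σ.Pred)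
    (ts : Fin (σ.arity P) → Term σ) :
    (atom P ts).ground e = atom (σ := Signature.ext.{u, v, w} σ) P
      fun i => .const ((ts i).eval constInl e) := by
  simp only [ground, lift, subst]
  congr 1
  funext i
  cases ts i <;> rfl

/-- The structures of the canonical model. -/
def CanonicalWorld.struct (p : Polarity) (a : CanonicalWorld.{u, v, w} σ) :
    Struct σ (Signature.ext.{u, v, w} σ).Const where
  carrier := constsBelow σ a.level
  -- Worlds have positive level, so a parameter of level `0` is available even if `σ` has no
  -- constants.
  nonempty := ⟨Sum.inr (0, .num 0), fun i t h => by cases h; exact Nat.succ_pos _⟩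
  const := constInl
  const_mem c := constInl_mem c _
  rel P := {d | (∀ i, d i ∈ constsBelow σ a.level) ∧ Prv a.theory
    (signed p (atom (σ := Signature.ext.{u, v, w} σ) P fun i => .const (d i)))}
  rel_mem _ _ hd i := hd.1 i

/-- The canonical model. -/
def canonicalModel (h : Nonempty (CanonicalWorld.{u, v, w} σ)) :
    Model.{u, v, max u v w} σ where
  World := CanonicalWorld.{u, v, w} σ
  world_nonempty := h
  R := CanonicalWorld.R
  D := (Signature.ext.{u, v, w} σ).Const
  pos := CanonicalWorld.struct .ver
  neg := CanonicalWorld.struct .fal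
  carrier_eq _ := rfl
  const_eq _ _ := rfl
  carrier_mono _ _ h := constsBelow_mono (h.1 ▸ Nat.le_succ _)
  const_rigid _ _ _ _ := rfl

/-- Both polarities are treated in one induction, since `∼` exchanges them and falsifying an
implication involves both. -/
theorem canonicalModel_sat_iff (h : Nonempty (CanonicalWorld.{u, v, w} σ)) (Φ : Formula σ)
    (p : Polarity) (a : CanonicalWorld.{u, v, w} σ)
    {e : Var → (Signature.ext.{u, v, w} σ).Const} (he : ∀ x, e x ∈ constsBelow σ a.level) :
    (canonicalModel h).Sat Φ p a e ↔ Prv a.theory (signed p (Φ.ground e)) := by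
  induction Φ generalizing p a e with
  | atom P ts =>
    have hmem : ∀ i, (ts i).eval constInl e ∈ constsBelow σ a.level := by
      intro i
      cases ts i with
      | var x => exact he x
      | const c => exact constInl_mem c _
    rw [ground_atom]
    cases p <;> exact and_iff_right hmem
  | bot =>
    cases p
    · exact iff_of_false id a.isTheory.consistent
    · exact iff_of_true trivial (.ax .sn5)
  | imp Φ Ψ ih₁ ih₂ =>
    have hΦ := ground_mem_sentencesBelow he Φ
    cases p
    · exact (or_congr (not_congr (ih₁ .ver a he)) (ih₂ .ver a he)).trans
        (a.isTheory.prv_imp_iff hΦ).symm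
    · exact (and_congr (ih₁ .ver a he) (ih₂ .fal a he)).trans <|
        IsTheory.prv_and_iff.symm.trans (Prv.ax (.sn2 _ _)).iff.symm
  | and Φ Ψ ih₁ ih₂ =>
    have hΦ := ground_mem_sentencesBelow he Φ
    cases p
    · exact (and_congr (ih₁ .ver a he) (ih₂ .ver a he)).trans IsTheory.prv_and_iff.symm
    · exact (or_congr (ih₁ .fal a he) (ih₂ .fal a he)).trans <|
        (a.isTheory.prv_or_iff (Φ := neg _) hΦ).symm.trans (Prv.ax (.sn4 _ _)).iff.symm
  | or Φ Ψ ih₁ ih₂ =>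
    have hΦ := ground_mem_sentencesBelow he Φ
    cases p
    · exact (or_congr (ih₁ .ver a he) (ih₂ .ver a he)).trans (a.isTheory.prv_or_iff hΦ).symm
    · exact (and_congr (ih₁ .fal a he) (ih₂ .fal a he)).trans <|
        IsTheory.prv_and_iff.symm.trans (Prv.ax (.sn3 _ _)).iff.symm
  | neg Φ ih =>
    cases p
    · exact ih .fal a he
    · exact (ih .ver a he).trans (Prv.ax (.sn1 _)).iff.symm
  | box Φ ih =>
    have hΦ := ground_mem_sentencesBelow he Φ
    have he' : ∀ b, a.R b → ∀ x, e x ∈ constsBelow σ b.level := fun b hb x =>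
      constsBelow_mono (hb.1 ▸ Nat.le_succ _) (he x)
    cases p
    · exact (forall_congr' fun b => forall_congr' fun hb => ih .ver b (he' b hb)).trans
        (CanonicalWorld.prv_box_iff hΦ).symm
    · refine (exists_congr fun b => and_congr_right fun hb => ih .fal b (he' b hb)).trans
        ((CanonicalWorld.prv_dia_iff (Φ := neg _) hΦ).symm.trans ?_)
      -- The negative half of the strong equivalence turns `∼□Φ` into `∼∼◇∼Φ`, hence into `◇∼Φ`.
      exact ((Prv.ax (.m3 (Φ.ground e))).right.iff.trans (Prv.ax (.sn1 _)).iff).symm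
  | dia Φ ih =>
    have hΦ := ground_mem_sentencesBelow he Φ
    have he' : ∀ b, a.R b → ∀ x, e x ∈ constsBelow σ b.level := fun b hb x =>
      constsBelow_mono (hb.1 ▸ Nat.le_succ _) (he x)
    cases p
    · exact (exists_congr fun b => and_congr_right fun hb => ih .ver b (he' b hb)).trans
        (CanonicalWorld.prv_dia_iff hΦ).symm
    · refine (forall_congr' fun b => forall_congr' fun hb => ih .fal b (he' b hb)).trans
        ((CanonicalWorld.prv_box_iff (Φ := neg _) hΦ).symm.trans ?_)
      exact ((Prv.ax (.m4 (Φ.ground e))).right.iff.trans (Prv.ax (.sn1 _)).iff).symm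
  | all x Φ ih =>
    have hΦ := ground_mem_sentencesBelow he (all x Φ)
    have he' : ∀ c ∈ constsBelow σ a.level, ∀ y,
        Function.update e x c y ∈ constsBelow σ a.level := fun c hc =>
      (Function.forall_update_iff e fun _ d => d ∈ constsBelow σ a.level).2 ⟨hc, fun y _ => he y⟩
    have ih' := fun p c hc => (ih p a (he' c hc)).trans (by rw [← ground_subst1])
    cases p
    · exact (forall_congr' fun c => forall_congr' fun hc => ih' .ver c hc).trans
        (a.isTheory.prv_all_iff hΦ).symm
    · exact (exists_congr fun c => and_congr_right fun hc => ih' .fal c hc).trans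
        ((a.isTheory.prv_ex_iff (Φ := neg _) hΦ).symm.trans (Prv.ax (.q3 x _)).iff.symm)
  | ex x Φ ih =>
    have hΦ := ground_mem_sentencesBelow he (ex x Φ)
    have he' : ∀ c ∈ constsBelow σ a.level, ∀ y,
        Function.update e x c y ∈ constsBelow σ a.level := fun c hc =>
      (Function.forall_update_iff e fun _ d => d ∈ constsBelow σ a.level).2 ⟨hc, fun y _ => he y⟩
    have ih' := fun p c hc => (ih p a (he' c hc)).trans (by rw [← ground_subst1])
    cases p
    · exact (exists_congr fun c => and_congr_right fun hc => ih' .ver c hc).trans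
        (a.isTheory.prv_ex_iff hΦ).symm
    · exact (forall_congr' fun c => forall_congr' fun hc => ih' .fal c hc).trans
        ((a.isTheory.prv_all_iff (Φ := neg _) hΦ).symm.trans (Prv.ax (.q4 x _)).iff.symm)

end Canonical

/-! ### Completeness -/

section Completeness

variable {σ : Signature.{u, v}}

open Formula

/-- Parameters that stand for the variables. -/
def varParam (x : Var) : (Signature.ext.{u, v, w} σ).Const := Sum.inr (0, .num x)

theorem varParam_mem (x : Var) : varParam.{u, v, w} x ∈ constsBelow σ 1 := by
  intro i t h
  cases h
  exact one_pos

theorem varParam_inj {x y : Var} : varParam.{u, v, w} (σ := σ) x = varParam y ↔ x = y := by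
  simp [varParam, Code.num_inj]

/-- Parameters that stand for the free variables of the conclusion can be replaced by these. -/
theorem Prv.of_ground {Γ : Set (Formula (Signature.ext.{u, v, w} σ))}
    (hΓ : ∀ Φ ∈ Γ, Φ.IsSentence) (hc : ∀ Φ ∈ Γ, ∀ x, Φ.ConstsIn {varParam x}ᶜ) {Φ : Formula σ}
    (h : Prv Γ (Φ.ground varParam)) : Prv Γ (Φ.lift _) := by
  -- Only the variables below `k` are replaced, so generalization on constants removes the
  -- parameters one at a time.
  let s (k : ℕ) (y : Var) : Term (Signature.ext.{u, v, w} σ) :=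
    if y < k then .const (varParam y) else .var y
  have hs : ∀ k, Prv Γ ((Φ.lift _).subst (s k)) → Prv Γ (Φ.lift _) := by
    intro k
    induction k with
    | zero =>
      intro h
      rwa [subst_eq_self fun x _ => by simp [s]] at h
    | succ k ih =>
      intro h
      refine ih (Prv.of_subst1_const (c := varParam k) (x := k) hΓ (fun Ψ hΨ => hc Ψ hΨ k) ?_ ?_)
      · refine (constsIn_lift (fun c => ?_) Φ).subst fun y c hy => ?_
        · simp [varParam]
        · by_cases hyk : y < k
          · simp only [s, if_pos hyk, Term.const.injEq] at hy
            rw [← hy, Set.mem_compl_singleton_iff, ne_eq, varParam_inj]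
            exact hyk.ne
          · simp [s, if_neg hyk] at hy
      · rw [subst1, subst_subst (s'' := s (k + 1))]
        · exact h
        · intro y
          rcases lt_trichotomy y k with hy | rfl | hy
          · simp [s, hy, Nat.lt_succ_of_lt hy, Term.subst]
          · simp [s, Term.subst]
          · simp [s, not_lt.2 hy.le, not_lt.2 (Nat.succ_le_of_lt hy), Term.subst, hy.ne']
        · intro y
          by_cases hy : y < k
          · exact Or.inr ⟨_, if_pos hy⟩
          · exact Or.inl (if_neg hy)
  refine hs (Φ.lift (ℕ × Code.{u, v, w} σ)).varBound ?_
  rwa [subst_congr (s' := fun x => .const (varParam x))]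
  exact fun x hx => if_pos hx.lt_varBound

/-- Enlarging the language is conservative: all new constants in a derivation can be sent to a
single sufficiently large variable, which leaves premises and conclusion unchanged. -/
theorem Prv.of_lift {A : Type w} {Γ : Set (Formula σ)} {Φ : Formula σ}
    (h : Prv ((fun Ψ => Ψ.lift A) '' Γ) (Φ.lift A)) : Prv Γ Φ := by
  obtain ⟨N, hN⟩ := h.replaceConst (K := σ.Const)
  let θ : (σ.adjoin A).Const → Term σ := Sum.elim .const fun _ => .var N
  have hlift : ∀ Ψ : Formula σ, Formula.replaceConst (K := σ.Const) θ (Ψ.lift A) = Ψ :=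
    replaceConst_lift fun c => rfl
  have h₁ : Prv (Formula.replaceConst (K := σ.Const) θ '' ((fun Ψ => Ψ.lift A) '' Γ))
      (Formula.replaceConst (K := σ.Const) θ (Φ.lift A)) := hN θ (by
    rintro (c | a) y hy
    · cases hy
    · cases hy
      exact le_rfl)
  rw [hlift] at h₁
  refine Prv.mono ?_ h₁
  rintro _ ⟨_, ⟨Ψ, hΨ, rfl⟩, rfl⟩
  exact (hlift Ψ).symm ▸ hΨ

theorem ground_disj (e : Var → (Signature.ext.{u, v, w} σ).Const) (l : List (Formula σ)) :
    disj (l.map (Formula.ground e)) = (disj l).ground e := by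
  induction l with
  | nil => rfl
  | cons Φ l ih =>
    cases l with
    | nil => rfl
    | cons Ψ l =>
      simp only [List.map_cons] at ih ⊢
      rw [disj, ih]
      rfl

theorem ground_eq_lift {Φ : Formula σ} (h : Φ.IsSentence)
    (e : Var → (Signature.ext.{u, v, w} σ).Const) : Φ.ground e = Φ.lift _ :=
  IsSentence.subst_eq (fun x hx => h x (isFree_lift.1 hx)) _

theorem Entails.proves {Γ Δ : Set (Formula σ)} (hΓ : ∀ Φ ∈ Γ, Φ.IsSentence)
    (h : Entails.{u, v, max u v w} Γ Δ) : Proves Γ Δ := by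
  let A := ℕ × Code.{u, v, w} σ
  let e : Var → (Signature.ext.{u, v, w} σ).Const := varParam
  let T : Set (Formula (Signature.ext.{u, v, w} σ)) :=
    (fun Φ => Φ.lift A) '' Γ ∪ (fun Φ => cneg (Φ.ground e)) '' Δ
  have hlift : ∀ Φ ∈ (fun Φ => Φ.lift A) '' Γ, Φ.IsSentence := by
    rintro _ ⟨Φ, hΦ, rfl⟩ x hx
    exact hΓ Φ hΦ x (isFree_lift.1 hx)
  by_cases hT : Prv T bot
  · obtain ⟨l, hl, hp⟩ := hT.exists_disj
    have hp' : Prv ((fun Φ => Φ.lift A) '' Γ) ((disj l).ground e) := by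
      rw [← ground_disj]
      exact .by_contra (Prv.head.mp hp.weaken)
    refine ⟨l, hl, (Prv.of_lift (hp'.of_ground hlift ?_)).derivable⟩
    rintro _ ⟨Φ, hΦ, rfl⟩ x
    exact constsIn_lift (fun c => by simp [varParam]) Φ
  · have hsub : T ⊆ sentencesBelow σ 1 := by
      rintro _ (hΦ | ⟨Φ, hΦ, rfl⟩)
      · refine ⟨hlift _ hΦ, ?_⟩
        obtain ⟨Φ, hΦ, rfl⟩ := hΦ
        exact constsIn_lift (fun c => constInl_mem c 1) Φ
      · exact cneg_mem_sentencesBelow (ground_mem_sentencesBelow varParam_mem Φ)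
    obtain ⟨T', hTT', hT'⟩ := exists_isTheory hsub hT
    -- `T` uses level `0` parameters for the variables, the witnesses have level `1`, so the world
    -- has level `2`, stored as index `1`.
    let a : CanonicalWorld.{u, v, w} σ := ⟨(1, T'), hT'⟩
    have he : ∀ x, e x ∈ constsBelow σ a.level := fun x =>
      constsBelow_mono one_le_two (varParam_mem x)
    let M := canonicalModel ⟨a⟩
    obtain ⟨Ψ, hΨ, hf⟩ := h M a (fun x => .const (Sum.inr (e x)))
      (fun x => Or.inr ⟨e x, he x, rfl⟩) (fun Φ hΦ =>
        (Model.forces_lift_iff (M := M) (hΓ Φ hΦ) e).2 <|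
          (canonicalModel_sat_iff ⟨a⟩ Φ .ver a he).2 <|
            .hyp (hTT' (Or.inl ⟨Φ, hΦ, (ground_eq_lift (hΓ Φ hΦ) e).symm⟩)))
    have hp : Prv T' (Ψ.ground e) := (canonicalModel_sat_iff ⟨a⟩ Ψ .ver a he).1
      ((Model.forces_iff_sat (M := M) (fun x => Or.inr rfl) .ver Ψ).1 hf)
    exact (hT'.consistent (hp.mp (.hyp (hTT' (Or.inr ⟨Ψ, hΨ, rfl⟩))))).elim

end Completeness

end QBK

theorem mainTheorem1 (σ : QBK.Signature.{u, v}) (Γ Δ : Set (QBK.Formula σ))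
    (hΓ : ∀ Φ ∈ Γ, Φ.IsSentence) :
    QBK.Proves Γ Δ ↔ QBK.Entails.{u, v, max u v w} Γ Δ :=
  ⟨fun h => h.entails hΓ, fun h => h.proves hΓ⟩
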